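/- For an integer $r\ge 2$, a family $\mathcal{F}$ of sets is called $r$-wise-intersecting if $E_1\cap\dots\cap E_r\neq\emptyset$ for all (not necessarily distinct) $E_1,\dots,E_r\in\mathcal{F}$, and non-trivial $r$-wise-intersecting if in addition $\bigcap_{E\in\mathcal{F}}E=\emptyset$. **Theorem.** For all positive integers $k$ and $d$ there is an integer $n_0=n_0(k,d)$ such that the following holds for every integer $p$ with $3\le p<k$ and $p\le d$ and every $n\ge n_0$. Let $\mathcal{H}$ be a family of $k$-element subsets of $[n]=\{1,\dots,n\}$ that has no non-trivial $(p-1)$-wise-intersecting subfamily $\mathcal{F}\subseteq\mathcal{H}$ with exactly $d+1$ members. Then $$|\mathcal{H}|\le\binom{n-1}{k-1},$$ and equality holds only if $\mathcal{H}$ is a star, i.e. there is a vertex $v\in[n]$ contained in every member of $\mathcal{H}$. -/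

import Mathlib

namespace WiseIntersecting

/-- A hypergraph on `V`, given by its finite set of edges, is `d`-wise-intersecting: any `d` edges
(repetitions allowed) have a common vertex. -/
def IsWiseIntersecting {V : Type*} (d : ℕ) (F : Finset (Finset V)) : Prop :=
  ∀ E : Fin d → Finset V, (∀ i, E i ∈ F) → ∃ v : V, ∀ i, v ∈ E i

/-- All edges contain a fixed vertex. -/
def IsStar {V : Type*} (F : Finset (Finset V)) : Prop :=
  ∃ v : V, ∀ E ∈ F, v ∈ E

/-- `d`-wise-intersecting, but no vertex lies in all edges. -/
def IsNontrivialWiseIntersecting {V : Type*} (d : ℕ) (F : Finset (Finset V)) : Prop :=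
  IsWiseIntersecting d F ∧ ¬ ∃ v : V, ∀ E ∈ F, v ∈ E

end WiseIntersecting

namespace WiseIntersecting

open scoped FinsetFamily

/-! Put r = p - 1, so that r + 2 ≤ k and r < d. If every edge of a family misses at most one of r +
1 fixed points, the family is r-wise intersecting; every forbidden subfamily below is certified in
this way.

Structure. In the spirit of the delta-system method, pass to a k-partite subfamily and clean it
until each colour is either freely exchangeable or determined by the rest of the edge. Unless
exactly one colour is determined, a forbidden subfamily appears (`IsHomogeneous.hasNontrivial`); if
exactly one is, its vertex is a centre of the edge (`IsHomogeneous.isCentered`). Hence all but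
O(n^(k-2)) edges of H have a centre (`exists_isCentered`), and a family without forbidden
subfamilies is at most a constant times as large as its shadow (`card_le_mul_card_shadow`).

Stability. A centre of E lies in every edge that meets E in at least r points, so the links of
different centres have disjoint shadows. If |H| is at least the size of a star, Kruskal–Katona makes
one link almost full (`exists_star_large`).

Exact bound. Let x be that centre, M the k-sets through x missing from H, and N the edges avoiding
x. An edge of N forces many of its small subsets to have large degree in M, and counting pairs of
such subsets gives |∂N| ≤ 8^k η |M| (`card_shadow_le`). With |N| ≤ C |∂N| and η small, 2|N| ≤ |M|.
As |H| is the size of a full star minus |M| plus |N|, the bound follows, and equality forces N = ∅.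
-/

/-- `H` contains a non-trivial `r`-wise-intersecting subfamily with `d + 1` members. -/
def HasNontrivial {V : Type*} (r d : ℕ) (H : Finset (Finset V)) : Prop :=
  ∃ F : Finset (Finset V), F ⊆ H ∧ F.card = d + 1 ∧ IsNontrivialWiseIntersecting r F

lemma HasNontrivial.mono {V : Type*} {r d : ℕ} {G H : Finset (Finset V)} (hGH : G ⊆ H)
    (h : HasNontrivial r d G) : HasNontrivial r d H := by
  obtain ⟨F, hF, h1⟩ := h
  exact ⟨F, hF.trans hGH, h1⟩

/-! ### Certificates for non-trivial intersecting families. -/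

/-- If every edge misses at most one point of a set with more than `r` points, then the family is
`r`-wise-intersecting. -/
lemma isWiseIntersecting_of_points {V : Type*} {r : ℕ} {F : Finset (Finset V)} (P : Finset V)
    (hP : r < P.card) (h : ∀ E ∈ F, ∀ u ∈ P, ∀ v ∈ P, u ∉ E → v ∉ E → u = v) :
    IsWiseIntersecting r F := by
  intro e he
  by_contra! hcon
  -- Without a common vertex each point of `P` is missed by some edge of the tuple; distinct points
  -- need distinct indices, and there are only `r`.
  choose i hi using hcon
  have hinj : Set.InjOn i P := by
    intro u hu v hv huv
    exact h (e (i u)) (he _) u hu v hv (hi u) (by rw [huv]; exact hi v)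
  have := Finset.card_le_card_of_injOn i (t := Finset.univ) (fun _ _ => Finset.mem_univ _) hinj
  simp at this
  omega

/-- Greedy choice of a sequence in which every term is `Q`-related to all earlier ones. -/
lemma exists_seq {α : Type*} [DecidableEq α] [Nonempty α] (P : ℕ → α → Prop) (Q : α → α → Prop)
    (N : ℕ)
    (h : ∀ i < N, ∀ Z : Finset α, Z.card ≤ i → ∃ a, P i a ∧ ∀ b ∈ Z, Q b a) :
    ∃ a : ℕ → α, (∀ i < N, P i (a i)) ∧ ∀ j < N, ∀ i < j, Q (a i) (a j) := by
  induction N with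
  | zero => exact ⟨fun _ => Classical.arbitrary α, by simp, by simp⟩
  | succ N ih =>
    obtain ⟨a, ha1, ha2⟩ := ih (fun i hi => h i (by omega))
    obtain ⟨b, hb1, hb2⟩ := h N (by omega) ((Finset.range N).image a)
      (Finset.card_image_le.trans (by simp))
    refine ⟨Function.update a N b, ?_, ?_⟩
    · intro i hi
      rcases eq_or_ne i N with rfl | hne
      · simpa using hb1
      · rw [Function.update_of_ne hne]
        exact ha1 i (by omega)
    · intro j hj i hij
      rw [Function.update_of_ne (by omega : i ≠ N)]
      rcases eq_or_ne j N with rfl | hne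
      · rw [Function.update_self]
        exact hb2 _ (Finset.mem_image_of_mem _ (by simpa using hij))
      · rw [Function.update_of_ne hne]
        exact ha2 j (by omega) i hij

/-- The certificate is `insert x S`: `F` misses only `x`, and an edge with trace `S.erase i` misses
only `i`. A common vertex would lie in `F`, hence in every trace, but the traces have empty
intersection. -/
lemma hasNontrivial_of_center {V : Type*} [DecidableEq V] {r d : ℕ} {H : Finset (Finset V)}
    (hr : 1 ≤ r) (hrd : r ≤ d) {F S : Finset V} {x : V} (hF : F ∈ H) (hx : x ∉ F) (hS : S ⊆ F)
    (hSr : S.card = r)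
    (h : ∀ i ∈ S, ∀ Z : Finset (Finset V), Z.card ≤ d →
      ∃ A ∈ H, A ∉ Z ∧ x ∈ A ∧ A ∩ F = S.erase i) : HasNontrivial r d H := by
  have e : Fin r ≃ S := (S.equivFinOfCardEq hSr).symm
  -- Cycling through `S`: since `r ≤ d`, every element of `S` is omitted by one of the `d` edges.
  let g : ℕ → V := fun l => e ⟨l % r, Nat.mod_lt _ hr⟩
  have hg : ∀ l, g l ∈ S := fun l => (e _).2
  obtain ⟨a, ha1, ha2⟩ := exists_seq
    (fun l A => A ∈ H ∧ x ∈ A ∧ A ∩ F = S.erase (g l)) (fun B A => A ≠ B) d (by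
      intro l hl Z hZ
      obtain ⟨A, hA, hAZ, hxA, hAF⟩ := h (g l) (hg l) Z (by omega)
      refine ⟨A, ⟨hA, hxA, hAF⟩, ?_⟩
      rintro b hb rfl
      exact hAZ hb)
  have hinj : Set.InjOn a (Finset.range d) := by
    intro i hi j hj hij
    simp only [Finset.coe_range, Set.mem_Iio] at hi hj
    rcases lt_trichotomy i j with h1 | h1 | h1
    · exact absurd hij.symm (ha2 j hj i h1)
    · exact h1
    · exact absurd hij (ha2 i hi j h1)
  have hFn : F ∉ (Finset.range d).image a := by
    intro hmem
    obtain ⟨l, hl, rfl⟩ := Finset.mem_image.1 hmem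
    exact hx (ha1 l (by simpa using hl)).2.1
  refine ⟨insert F ((Finset.range d).image a), ?_, ?_, ?_, ?_⟩
  · intro A hA
    rcases Finset.mem_insert.1 hA with rfl | hA
    · exact hF
    · obtain ⟨l, hl, rfl⟩ := Finset.mem_image.1 hA
      exact (ha1 l (by simpa using hl)).1
  · rw [Finset.card_insert_of_notMem hFn, Finset.card_image_of_injOn hinj, Finset.card_range]
  · have hxS : x ∉ S := fun h' => hx (hS h')
    refine isWiseIntersecting_of_points (insert x S)
      (by rw [Finset.card_insert_of_notMem hxS]; omega) ?_
    intro A hA u hu v hv huA hvA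
    rcases Finset.mem_insert.1 hA with rfl | hA
    · rcases Finset.mem_insert.1 hu with rfl | hu
      · rcases Finset.mem_insert.1 hv with rfl | hv
        · rfl
        · exact absurd (hS hv) hvA
      · exact absurd (hS hu) huA
    · obtain ⟨l, hl, rfl⟩ := Finset.mem_image.1 hA
      obtain ⟨-, hxA, hAF⟩ := ha1 l (by simpa using hl)
      have key : ∀ w ∈ insert x S, w ∉ a l → w = g l := by
        intro w hw hwA
        rcases Finset.mem_insert.1 hw with rfl | hw
        · exact absurd hxA hwA
        · by_contra hne
          have : w ∈ a l ∩ F := by rw [hAF]; exact Finset.mem_erase.2 ⟨hne, hw⟩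
          exact hwA (Finset.mem_inter.1 this).1
      rw [key u hu huA, key v hv hvA]
  · rintro ⟨v, hv⟩
    have hvF : v ∈ F := hv F (Finset.mem_insert_self _ _)
    have hmem : ∀ l < d, v ∈ S.erase (g l) := by
      intro l hl
      rw [← (ha1 l hl).2.2]
      exact Finset.mem_inter.2 ⟨hv _ (Finset.mem_insert_of_mem
        (Finset.mem_image_of_mem _ (by simpa using hl))), hvF⟩
    have hvS : v ∈ S := (Finset.mem_erase.1 (hmem 0 (by omega))).2
    have hlt := (e.symm ⟨v, hvS⟩).2
    have h2 := hmem (e.symm ⟨v, hvS⟩) (by omega)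
    have h3 : g (e.symm ⟨v, hvS⟩) = v := by
      simp only [g, Nat.mod_eq_of_lt hlt, Fin.eta, Equiv.apply_symm_apply]
    rw [h3] at h2
    simp at h2

/-! ### Cleaning by degrees. -/

/-- Deleting, as long as possible, all elements with a key of degree below `s`. -/
lemma exists_clean {α β : Type*} [DecidableEq α] [DecidableEq β] [Nonempty β] (keys : α → Finset β)
    (s : ℕ) (G : Finset α) :
    ∃ G' ⊆ G, ∃ τ : α → β,
      (∀ E ∈ G', ∀ κ ∈ keys E, s ≤ (G'.filter fun A => κ ∈ keys A).card) ∧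
      (∀ E ∈ G \ G', τ E ∈ keys E) ∧
      ∀ κ, ((G \ G').filter fun E => τ E = κ).card ≤ s := by
  induction G using Finset.strongInduction with
  | H G ih =>
    by_cases hc : ∀ E ∈ G, ∀ κ ∈ keys E, s ≤ (G.filter fun A => κ ∈ keys A).card
    · exact ⟨G, subset_rfl, fun _ => Classical.arbitrary β, hc, by simp, by simp⟩
    · push Not at hc
      obtain ⟨E, hE, κ, hκ, hlt⟩ := hc
      -- All elements with the poor key `κ` go at once and are labelled `κ`; the label cannot recur,
      -- since no remaining element has this key.
      set G1 := G.filter fun A => κ ∉ keys A with hG1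
      have hss : G1 ⊂ G := by
        refine Finset.filter_ssubset.2 ⟨E, hE, by simpa using hκ⟩
      obtain ⟨G', hG', τ, h1, h2, h3⟩ := ih G1 hss
      have hmem : ∀ A ∈ G, κ ∉ keys A → A ∈ G1 := fun A hA h => Finset.mem_filter.2 ⟨hA, h⟩
      refine ⟨G', hG'.trans hss.subset, fun A => if κ ∈ keys A then κ else τ A, h1, ?_, ?_⟩
      · intro A hA
        rw [Finset.mem_sdiff] at hA
        by_cases hk : κ ∈ keys A
        · simp [hk]
        · simpa [hk] using h2 A (Finset.mem_sdiff.2 ⟨hmem A hA.1 hk, hA.2⟩)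
      · intro κ'
        by_cases hkk : κ' = κ
        · subst hkk
          refine le_trans (Finset.card_le_card ?_) hlt.le
          intro A hA
          simp only [Finset.mem_filter, Finset.mem_sdiff] at hA ⊢
          refine ⟨hA.1.1, ?_⟩
          by_contra hk
          have := hA.2
          rw [if_neg hk] at this
          exact hk (this ▸ h2 A (Finset.mem_sdiff.2 ⟨hmem A hA.1.1 hk, hA.1.2⟩))
        · refine le_trans (Finset.card_le_card ?_) (h3 κ')
          intro A hA
          simp only [Finset.mem_filter, Finset.mem_sdiff] at hA ⊢
          by_cases hk : κ ∈ keys A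
          · have := hA.2
            rw [if_pos hk] at this
            exact absurd this.symm hkk
          · have := hA.2
            rw [if_neg hk] at this
            exact ⟨⟨hmem A hA.1.1 hk, hA.1.2⟩, this⟩

/-! ### Rainbow families and homogeneous subfamilies. -/

section Rainbow

variable {V : Type*} {k : ℕ}

/-- `E` contains exactly one vertex of every colour. -/
def IsRainbow (f : V → Fin k) (E : Finset V) : Prop :=
  E.card = k ∧ Set.InjOn f E

/-- The part of `E` with colours outside `C`. -/
def res (f : V → Fin k) (C : Finset (Fin k)) (E : Finset V) : Finset V :=
  E.filter fun v => f v ∉ C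

lemma mem_res {f : V → Fin k} {C : Finset (Fin k)} {E : Finset V} {v : V} :
    v ∈ res f C E ↔ v ∈ E ∧ f v ∉ C := Finset.mem_filter

lemma IsRainbow.exists_mem {f : V → Fin k} {E : Finset V} (h : IsRainbow f E) (i : Fin k) :
    ∃ v ∈ E, f v = i := by
  classical
  have : E.image f = Finset.univ := by
    apply Finset.eq_univ_of_card
    rw [Finset.card_image_of_injOn h.2, h.1, Fintype.card_fin]
  have hi := Finset.mem_univ i
  rw [← this] at hi
  simpa using hi

lemma IsRainbow.card_res {f : V → Fin k} {E : Finset V} (h : IsRainbow f E)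
    (C : Finset (Fin k)) : (res f C E).card = k - C.card := by
  classical
  have : (res f C E).image f = Cᶜ := by
    ext i
    simp only [Finset.mem_image, mem_res, Finset.mem_compl]
    constructor
    · rintro ⟨v, ⟨-, hv⟩, rfl⟩
      exact hv
    · intro hi
      obtain ⟨v, hv, rfl⟩ := h.exists_mem i
      exact ⟨v, ⟨hv, hi⟩, rfl⟩
  rw [← Finset.card_image_of_injOn (f := f) (s := res f C E), this, Finset.card_compl,
    Fintype.card_fin]
  exact h.2.mono (Finset.filter_subset _ _)

variable [DecidableEq V]

/-- Inside `G`, edges are determined by their restriction away from a single colour of `B`, while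
restrictions away from a single colour outside `B`, or away from two colours of `B`, have degree
at least `s`. -/
structure IsHomogeneous (f : V → Fin k) (s : ℕ) (B : Finset (Fin k)) (G : Finset (Finset V)) :
    Prop where
  own : ∀ i ∈ B, ∀ E ∈ G, ∀ A ∈ G, res f {i} A = res f {i} E → A = E
  single : ∀ i ∉ B, ∀ E ∈ G, s ≤ (G.filter fun A => res f {i} A = res f {i} E).card
  pair : ∀ i ∈ B, ∀ j ∈ B, i ≠ j → ∀ E ∈ G,
    s ≤ (G.filter fun A => res f {i, j} A = res f {i, j} E).card

/-- The colour sets whose restrictions are required to have large degree. -/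
def cleanTypes (B : Finset (Fin k)) : Finset (Finset (Fin k)) :=
  Finset.univ.filter fun C => (∃ i ∉ B, C = {i}) ∨ ∃ i ∈ B, ∃ j ∈ B, i ≠ j ∧ C = {i, j}

lemma mem_cleanTypes {B C : Finset (Fin k)} : C ∈ cleanTypes B ↔
    (∃ i ∉ B, C = {i}) ∨ ∃ i ∈ B, ∃ j ∈ B, i ≠ j ∧ C = {i, j} := by
  simp [cleanTypes]

/-- The threshold in `exists_isHomogeneous`. -/
def homConst (k s : ℕ) : ℕ → ℕ
  | 0 => s * 2 ^ k
  | j + 1 => s * 2 ^ k + k * (s * homConst k s j)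

variable [Fintype V]

/-- Clean with respect to all types in `cleanTypes B`. If nothing survives, edges with a two-colour
label are few, because such a label is a type and a (k-2)-set used at most `s` times. The others are
labelled by a single colour outside `B`; keeping one edge per label makes that colour determined by
the rest of the edge. -/
lemma exists_isHomogeneous_or_step (f : V → Fin k) (s : ℕ) (B : Finset (Fin k))
    (G : Finset (Finset V)) (hG : ∀ E ∈ G, IsRainbow f E)
    (hown : ∀ i ∈ B, ∀ E ∈ G, ∀ A ∈ G, res f {i} A = res f {i} E → A = E)
    (hcard : s * 2 ^ k * (Fintype.card V).choose (k - 2) < G.card) :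
    (∃ G' ⊆ G, G'.Nonempty ∧ IsHomogeneous f s B G') ∨
    ∃ i ∉ B, ∃ G' ⊆ G, (∀ E ∈ G', ∀ A ∈ G', res f {i} A = res f {i} E → A = E) ∧
      G.card ≤ s * 2 ^ k * (Fintype.card V).choose (k - 2) + k * (s * G'.card) := by
  obtain ⟨G', hG', τ, h1, h2, h3⟩ := exists_clean
    (fun E : Finset V => (cleanTypes B).image fun C => (C, res f C E)) s G
  have hdeg : ∀ C ∈ cleanTypes B, ∀ E ∈ G',
      s ≤ (G'.filter fun A => res f C A = res f C E).card := by
    intro C hC E hE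
    refine (h1 E hE (C, res f C E) (Finset.mem_image_of_mem _ hC)).trans
      (Finset.card_le_card ?_)
    intro A hA
    simp only [Finset.mem_filter, Finset.mem_image, Prod.mk.injEq] at hA ⊢
    obtain ⟨hA, C', -, rfl, h⟩ := hA
    exact ⟨hA, h⟩
  by_cases hne : G'.Nonempty
  · refine Or.inl ⟨G', hG', hne, ?_, ?_, ?_⟩
    · exact fun i hi E hE A hA h => hown i hi E (hG' hE) A (hG' hA) h
    · exact fun i hi E hE => hdeg {i} (mem_cleanTypes.2 (Or.inl ⟨i, hi, rfl⟩)) E hE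
    · exact fun i hi j hj hij E hE =>
        hdeg {i, j} (mem_cleanTypes.2 (Or.inr ⟨i, hi, j, hj, hij, rfl⟩)) E hE
  · rw [Finset.not_nonempty_iff_eq_empty] at hne
    subst hne
    rw [Finset.sdiff_empty] at h2 h3
    right
    have hτ : ∀ E ∈ G, (τ E).1 ∈ cleanTypes B ∧ (τ E).2 = res f (τ E).1 E := by
      intro E hE
      obtain ⟨C, hC, h⟩ := Finset.mem_image.1 (h2 E hE)
      rw [← h]
      exact ⟨hC, rfl⟩
    let X := G.filter fun E => (τ E).1.card = 2
    let Y : Fin k → Finset (Finset V) := fun i => G.filter fun E => (τ E).1 = {i}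
    have hX : X.card ≤ s * 2 ^ k * (Fintype.card V).choose (k - 2) := by
      have himg : X.image τ ⊆ (Finset.univ : Finset (Finset (Fin k))) ×ˢ
          Finset.powersetCard (k - 2) (Finset.univ : Finset V) := by
        intro p hp
        obtain ⟨E, hE, rfl⟩ := Finset.mem_image.1 hp
        obtain ⟨hE, hE2⟩ := Finset.mem_filter.1 hE
        simp only [Finset.mem_product, Finset.mem_univ, true_and, Finset.mem_powersetCard,
          Finset.subset_univ]
        rw [(hτ E hE).2, (hG E hE).card_res, hE2]
      have h4 := Finset.card_le_card himg
      rw [Finset.card_product, Finset.card_powersetCard, Finset.card_univ, Finset.card_univ,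
        Fintype.card_finset, Fintype.card_fin] at h4
      calc X.card ≤ s * (X.image τ).card := Finset.card_le_mul_card_image _ _ (by
            intro κ _
            exact (Finset.card_le_card (Finset.filter_subset_filter _
              (Finset.filter_subset _ _))).trans (h3 κ))
        _ ≤ s * (2 ^ k * (Fintype.card V).choose (k - 2)) := Nat.mul_le_mul_left _ h4
        _ = _ := by ring
    have hcov : G ⊆ X ∪ Bᶜ.biUnion Y := by
      intro E hE
      rcases mem_cleanTypes.1 (hτ E hE).1 with ⟨i, hi, h⟩ | ⟨i, hi, j, hj, hij, h⟩
      · refine Finset.mem_union_right _ (Finset.mem_biUnion.2 ⟨i, by simpa using hi, ?_⟩)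
        exact Finset.mem_filter.2 ⟨hE, h⟩
      · refine Finset.mem_union_left _ (Finset.mem_filter.2 ⟨hE, ?_⟩)
        rw [h, Finset.card_pair hij]
    have hpick : ∀ i, ∃ W ⊆ Y i, Set.InjOn τ W ∧ W.image τ = (Y i).image τ := by
      intro i
      obtain ⟨W, h4, h5, h6⟩ := Finset.exists_subset_injOn_image_eq_of_surjOn
        (f := τ) (Y i : Set (Finset V)) ((Y i).image τ)
        (by rw [Finset.coe_image]; exact Set.surjOn_image _ _)
      exact ⟨W, by exact_mod_cast h4, h5, h6⟩
    choose W hWY hWinj hWimg using hpick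
    have hYW : ∀ i, (Y i).card ≤ s * (W i).card := by
      intro i
      rw [← Finset.card_image_of_injOn (hWinj i), hWimg]
      refine Finset.card_le_mul_card_image _ _ ?_
      intro κ _
      exact (Finset.card_le_card (Finset.filter_subset_filter _
        (Finset.filter_subset _ _))).trans (h3 κ)
    have hle : G.card ≤ X.card + (Bᶜ.biUnion Y).card :=
      (Finset.card_le_card hcov).trans (Finset.card_union_le _ _)
    -- Otherwise `X` alone would cover `G`, against `hcard`.
    have hBne : Bᶜ.Nonempty := by
      by_contra hB
      rw [Finset.not_nonempty_iff_eq_empty] at hB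
      rw [hB] at hle
      simp at hle
      omega
    obtain ⟨i, hi, hmax⟩ := Finset.exists_max_image Bᶜ (fun i => (W i).card) hBne
    refine ⟨i, by simpa using hi, W i, (hWY i).trans (Finset.filter_subset _ _), ?_, ?_⟩
    · intro E hE A hA hEA
      obtain ⟨hE1, hE2⟩ := Finset.mem_filter.1 (hWY i hE)
      obtain ⟨hA1, hA2⟩ := Finset.mem_filter.1 (hWY i hA)
      refine hWinj i hA hE (Prod.ext (hA2.trans hE2.symm) ?_)
      rw [(hτ A hA1).2, (hτ E hE1).2, hA2, hE2, hEA]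
    · have hY : (Bᶜ.biUnion Y).card ≤ k * (s * (W i).card) := by
        refine (Finset.card_biUnion_le_card_mul Bᶜ Y (s * (W i).card) ?_).trans ?_
        · exact fun l hl => (hYW l).trans (Nat.mul_le_mul_left _ (hmax l hl))
        · refine Nat.mul_le_mul_right _ ((Finset.card_le_univ _).trans ?_)
          simp
      omega

/-- Each unsuccessful step adds a colour to `B`, so there are at most `j` of them; the recursion of
`homConst` pays for the loss in each. -/
lemma exists_isHomogeneous (f : V → Fin k) (s j : ℕ) (B : Finset (Fin k))
    (hj : Bᶜ.card = j) (G : Finset (Finset V)) (hG : ∀ E ∈ G, IsRainbow f E)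
    (hown : ∀ i ∈ B, ∀ E ∈ G, ∀ A ∈ G, res f {i} A = res f {i} E → A = E)
    (hcard : homConst k s j * (Fintype.card V).choose (k - 2) < G.card) :
    ∃ B', ∃ G' ⊆ G, G'.Nonempty ∧ IsHomogeneous f s B' G' := by
  induction j generalizing B G with
  | zero =>
    rcases exists_isHomogeneous_or_step f s B G hG hown hcard with ⟨G', h1, h2, h3⟩ | h
    · exact ⟨B, G', h1, h2, h3⟩
    · obtain ⟨i, hi, -⟩ := h
      have : i ∈ Bᶜ := by simpa using hi
      rw [Finset.card_eq_zero] at hj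
      simp [hj] at this
  | succ j ih =>
    simp only [homConst, add_mul] at hcard
    rcases exists_isHomogeneous_or_step f s B G hG hown (by omega) with
      ⟨G', h1, h2, h3⟩ | ⟨i, hi, G', h1, h2, h3⟩
    · exact ⟨B, G', h1, h2, h3⟩
    · obtain ⟨B', G'', h4, h5⟩ := ih (insert i B) (by
          rw [Finset.card_compl, Finset.card_insert_of_notMem hi]
          rw [Finset.card_compl] at hj
          omega) G' (fun E hE => hG E (h1 hE)) (by
          intro l hl E hE A hA
          rcases Finset.mem_insert.1 hl with rfl | hl
          · exact h2 E hE A hA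
          · exact hown l hl E (h1 hE) A (h1 hA)) (by
          have h6 := lt_of_lt_of_le hcard h3
          have h7 : k * s * (homConst k s j * (Fintype.card V).choose (k - 2)) <
              k * s * G'.card := by nlinarith
          exact lt_of_mul_lt_mul_left h7 (Nat.zero_le _))
      exact ⟨B', G'', h4.trans h1, h5⟩

end Rainbow

/-! ### Exchanging vertices in homogeneous families. -/

section Exchange

variable {V : Type*} {k : ℕ}

/-- Every edge can be exchanged on the colours of `C` so as to avoid any `m` given vertices. -/
def IsExchangeable (f : V → Fin k) (m : ℕ) (G : Finset (Finset V)) (C : Finset (Fin k)) : Prop :=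
  ∀ E ∈ G, ∀ Z : Finset V, Z.card ≤ m →
    ∃ A ∈ G, res f C A = res f C E ∧ ∀ v ∈ A, f v ∈ C → v ∉ Z

lemma res_union_congr {f : V → Fin k} {C D : Finset (Fin k)} {A E : Finset V}
    (h : res f C A = res f C E) : res f (C ∪ D) A = res f (C ∪ D) E := by
  ext v
  have := Finset.ext_iff.1 h v
  simp only [mem_res, Finset.mem_union, not_or] at this ⊢
  tauto

lemma IsExchangeable.empty (f : V → Fin k) (m : ℕ) (G : Finset (Finset V)) :
    IsExchangeable f m G ∅ :=
  fun E hE _ _ => ⟨E, hE, rfl, by simp⟩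

lemma IsRainbow.eq_of_mem {f : V → Fin k} {E : Finset V} (h : IsRainbow f E) {u v : V}
    (hu : u ∈ E) (hv : v ∈ E) (huv : f u = f v) : u = v := h.2 hu hv huv

lemma eq_of_res_empty {f : V → Fin k} {A E : Finset V} (h : res f ∅ A = res f ∅ E) : A = E := by
  simpa [res] using h

/-- Exchange on `C`, then on `D`: vertices with colour in `C \ D` survive the second exchange and
still avoid `Z`. -/
lemma IsExchangeable.union {f : V → Fin k} {m : ℕ} {G : Finset (Finset V)}
    {C D : Finset (Fin k)} (hC : IsExchangeable f m G C) (hD : IsExchangeable f m G D) :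
    IsExchangeable f m G (C ∪ D) := by
  intro E hE Z hZ
  obtain ⟨A, hA, hAE, hAZ⟩ := hC E hE Z hZ
  obtain ⟨A', hA', hAE', hAZ'⟩ := hD A hA Z hZ
  refine ⟨A', hA', ?_, ?_⟩
  · rw [← res_union_congr hAE, Finset.union_comm, res_union_congr hAE']
  · intro v hv hvC hvZ
    by_cases hvD : f v ∈ D
    · exact hAZ' v hv hvD hvZ
    · have : v ∈ res f D A := hAE' ▸ mem_res.2 ⟨hv, hvD⟩
      exact hAZ v (mem_res.1 this).1 ((Finset.mem_union.1 hvC).resolve_right hvD) hvZ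

lemma IsExchangeable.of_cover {f : V → Fin k} {m : ℕ} {G : Finset (Finset V)}
    {C : Finset (Fin k)} (h : ∀ c ∈ C, ∃ D ⊆ C, c ∈ D ∧ IsExchangeable f m G D) :
    IsExchangeable f m G C := by
  have hex : ∀ c : Fin k, ∃ D ⊆ C, (c ∈ C → c ∈ D) ∧ IsExchangeable f m G D := by
    intro c
    by_cases hc : c ∈ C
    · obtain ⟨D, h1, h2, h3⟩ := h c hc
      exact ⟨D, h1, fun _ => h2, h3⟩
    · exact ⟨∅, by simp, fun h => absurd h hc, IsExchangeable.empty f m G⟩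
  choose D h1 h2 h3 using hex
  have hU : ∀ S : Finset (Fin k), IsExchangeable f m G (S.biUnion D) := by
    intro S
    induction S using Finset.induction with
    | empty => simpa using IsExchangeable.empty f m G
    | insert a S _ ih =>
      rw [Finset.biUnion_insert]
      exact (h3 a).union ih
  have : C = C.biUnion D := by
    apply Finset.Subset.antisymm
    · exact fun c hc => Finset.mem_biUnion.2 ⟨c, hc, h2 c hc⟩
    · exact Finset.biUnion_subset.2 fun c _ => h1 c
  rw [this]
  exact hU C

/-- Two rainbow edges that agree away from `C`, and share a vertex of colour `i ∈ C`, agree away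
from `C.erase i`. -/
lemma res_erase_congr {f : V → Fin k} {C : Finset (Fin k)} {A A' : Finset V}
    (hA : IsRainbow f A) (hA' : IsRainbow f A') (h : res f C A = res f C A') {z : V}
    (hz : z ∈ A) (hz' : z ∈ A') : res f (C.erase (f z)) A = res f (C.erase (f z)) A' := by
  ext v
  have := Finset.ext_iff.1 h v
  simp only [mem_res, Finset.mem_erase, not_and] at this ⊢
  by_cases hvz : f v = f z
  · constructor
    · rintro ⟨hv, -⟩
      rw [hA.eq_of_mem hv hz hvz]
      exact ⟨hz', by simp⟩
    · rintro ⟨hv, -⟩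
      rw [hA'.eq_of_mem hv hz' hvz]
      exact ⟨hz, by simp⟩
  · simp only [ne_eq, hvz, not_false_eq_true, forall_const]
    exact this

variable [DecidableEq V]

/-- Two candidates agreeing off `C` and sharing a vertex of colour `i ∈ C` agree off `C.erase i`, so
they coincide. Each vertex of `Z` thus spoils at most one of the `s > m` candidates. -/
lemma IsExchangeable.of_degree {f : V → Fin k} {m s : ℕ} (hs : m < s) {G : Finset (Finset V)}
    (hG : ∀ E ∈ G, IsRainbow f E) {C : Finset (Fin k)}
    (hC : ∀ i ∈ C, ∀ E ∈ G, ∀ A ∈ G, res f (C.erase i) A = res f (C.erase i) E → A = E)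
    (hdeg : ∀ E ∈ G, s ≤ (G.filter fun A => res f C A = res f C E).card) :
    IsExchangeable f m G C := by
  intro E hE Z hZ
  by_contra! hcon
  have hz : ∀ A : Finset V, ∃ z : V, A ∈ (G.filter fun A => res f C A = res f C E) →
      z ∈ A ∧ f z ∈ C ∧ z ∈ Z := by
    intro A
    by_cases hA : A ∈ (G.filter fun A => res f C A = res f C E)
    · obtain ⟨h1, h2⟩ := Finset.mem_filter.1 hA
      obtain ⟨v, hv⟩ := hcon A h1 h2
      exact ⟨v, fun _ => hv⟩
    · obtain ⟨v, hv⟩ := hcon E hE rfl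
      exact ⟨v, fun h => absurd h hA⟩
  choose z hz using hz
  have := Finset.card_le_card_of_injOn z (s := G.filter fun A => res f C A = res f C E) (t := Z)
    (fun A hA => (hz A hA).2.2) (by
      intro A hA A' hA' hAA'
      have hA1 := Finset.mem_filter.1 hA
      have hA1' := Finset.mem_filter.1 hA'
      refine hC (f (z A)) (hz A hA).2.1 A' hA1'.1 A hA1.1 ?_
      refine res_erase_congr (hG _ hA1.1) (hG _ hA1'.1) (hA1.2.trans hA1'.2.symm) (hz A hA).1 ?_
      rw [hAA']
      exact (hz A' hA').1)
  have := hdeg E hE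
  omega

lemma IsHomogeneous.isExchangeable_singleton {f : V → Fin k} {m s : ℕ} (hs : m < s)
    {B : Finset (Fin k)} {G : Finset (Finset V)} (hG : ∀ E ∈ G, IsRainbow f E)
    (h : IsHomogeneous f s B G) {i : Fin k} (hi : i ∉ B) : IsExchangeable f m G {i} := by
  refine IsExchangeable.of_degree hs hG ?_ (h.single i hi)
  intro j hj E _ A _ hEA
  rw [Finset.mem_singleton.1 hj, Finset.erase_singleton] at hEA
  exact eq_of_res_empty hEA

lemma IsHomogeneous.isExchangeable_pair {f : V → Fin k} {m s : ℕ} (hs : m < s)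
    {B : Finset (Fin k)} {G : Finset (Finset V)} (hG : ∀ E ∈ G, IsRainbow f E)
    (h : IsHomogeneous f s B G) {i j : Fin k} (hi : i ∈ B) (hj : j ∈ B) (hij : i ≠ j) :
    IsExchangeable f m G {i, j} := by
  refine IsExchangeable.of_degree hs hG ?_ (h.pair i hi j hj hij)
  intro l hl E hE A hA hEA
  rcases Finset.mem_insert.1 hl with rfl | hl
  · have : ({l, j} : Finset (Fin k)).erase l = {j} := by
      ext x; simp; grind
    rw [this] at hEA
    exact h.own j hj E hE A hA hEA
  · rw [Finset.mem_singleton.1 hl] at hEA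
    have : ({i, j} : Finset (Fin k)).erase j = {i} := by
      ext x; simp; grind
    rw [this] at hEA
    exact h.own i hi E hE A hA hEA

/-- Every subset of `E` through `c` is the trace on `E` of an edge of `H` whose other vertices
avoid any `m` given vertices. -/
def IsCentered (m : ℕ) (H : Finset (Finset V)) (E : Finset V) (c : V) : Prop :=
  c ∈ E ∧ ∀ T ⊆ E, c ∈ T → ∀ Z : Finset V, Z.card ≤ m →
    ∃ A ∈ H, A ∩ E = T ∧ ∀ v ∈ A, v ∉ E → v ∉ Z

lemma IsCentered.mono {m : ℕ} {G H : Finset (Finset V)} (hGH : G ⊆ H) {E : Finset V} {c : V}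
    (h : IsCentered m G E c) : IsCentered m H E c := by
  refine ⟨h.1, fun T hT hc Z hZ => ?_⟩
  obtain ⟨A, hA, h'⟩ := h.2 T hT hc Z hZ
  exact ⟨A, hGH hA, h'⟩

/-- Exchanging on `C` while avoiding `E` itself yields the trace `res f C E` on `E`. -/
lemma IsExchangeable.exists_inter_eq {f : V → Fin k} {m : ℕ} {G : Finset (Finset V)}
    {C : Finset (Fin k)} (hC : IsExchangeable f (m + k) G C) (hG : ∀ E ∈ G, IsRainbow f E)
    {E : Finset V} (hE : E ∈ G) {Z : Finset V} (hZ : Z.card ≤ m) :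
    ∃ A ∈ G, A ∩ E = res f C E ∧ ∀ v ∈ A, v ∉ E → v ∉ Z := by
  obtain ⟨A, hA, h1, h2⟩ := hC E hE (Z ∪ E)
    ((Finset.card_union_le _ _).trans (Nat.add_le_add hZ (hG E hE).1.le))
  refine ⟨A, hA, ?_, ?_⟩
  · ext v
    constructor
    · intro hv
      obtain ⟨hvA, hvE⟩ := Finset.mem_inter.1 hv
      refine mem_res.2 ⟨hvE, fun hvC => h2 v hvA hvC (Finset.mem_union_right _ hvE)⟩
    · intro hv
      have hvE := (mem_res.1 hv).1
      rw [← h1] at hv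
      exact Finset.mem_inter.2 ⟨(mem_res.1 hv).1, hvE⟩
  · intro v hv hvE hvZ
    by_cases hvC : f v ∈ C
    · exact h2 v hv hvC (Finset.mem_union_left _ hvZ)
    · have : v ∈ res f C A := mem_res.2 ⟨hv, hvC⟩
      rw [h1] at this
      exact hvE (mem_res.1 this).1

/-- The centre is the vertex of colour `b`. All other colours are exchangeable singly, hence
jointly, so the vertices of `E \ T` can be replaced. -/
lemma IsHomogeneous.isCentered {f : V → Fin k} {m s : ℕ} (hs : m + k < s) {b : Fin k}
    {G : Finset (Finset V)} (hG : ∀ E ∈ G, IsRainbow f E) (h : IsHomogeneous f s {b} G)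
    {E : Finset V} (hE : E ∈ G) : ∃ c, IsCentered m G E c := by
  obtain ⟨c, hcE, hcb⟩ := (hG E hE).exists_mem b
  refine ⟨c, hcE, fun T hT hcT Z hZ => ?_⟩
  have hC : IsExchangeable f (m + k) G ((E \ T).image f) := by
    refine IsExchangeable.of_cover fun i hi => ⟨{i}, by simpa using hi, by simp, ?_⟩
    refine h.isExchangeable_singleton hs hG ?_
    rw [Finset.mem_singleton]
    rintro rfl
    obtain ⟨v, hv, hvi⟩ := Finset.mem_image.1 hi
    rw [Finset.mem_sdiff] at hv
    rw [← hcb] at hvi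
    exact hv.2 ((hG E hE).eq_of_mem hv.1 hcE hvi ▸ hcT)
  obtain ⟨A, hA, h1, h2⟩ := hC.exists_inter_eq hG hE hZ
  refine ⟨A, hA, h1.trans ?_, h2⟩
  ext v
  rw [mem_res]
  constructor
  · rintro ⟨hv, hn⟩
    by_contra hvT
    exact hn (Finset.mem_image_of_mem f (Finset.mem_sdiff.2 ⟨hv, hvT⟩))
  · intro hv
    refine ⟨hT hv, fun hn => ?_⟩
    obtain ⟨u, hu, huv⟩ := Finset.mem_image.1 hn
    rw [Finset.mem_sdiff] at hu
    exact hu.2 ((hG E hE).eq_of_mem hu.1 (hT hv) huv ▸ hv)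

/-- Fix `E` and take edges with traces `res f (C l) E`, pairwise disjoint outside `E`. The vertices
of `E` with the private colours `q l` are the r + 1 certifying points. No vertex of `E` is common
because the `C l` cover all colours. -/
lemma hasNontrivial_of_cover {f : V → Fin k} {r d : ℕ} (hr : 1 ≤ r) (hrd : r ≤ d)
    {G : Finset (Finset V)}
    (hG : ∀ E ∈ G, IsRainbow f E) (hne : G.Nonempty) (C : ℕ → Finset (Fin k)) (q : ℕ → Fin k)
    (hC : ∀ l ≤ r, IsExchangeable f ((d + 1) * k + k) G (C l)) (hq : ∀ l ≤ r, q l ∈ C l)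
    (hqC : ∀ l ≤ r, ∀ l' ≤ r, q l ∈ C l' → l = l') (hcov : ∀ i, ∃ l ≤ r, i ∈ C l) :
    HasNontrivial r d G := by
  obtain ⟨E, hE⟩ := hne
  obtain ⟨a, ha1, ha2⟩ := exists_seq
    -- `min l r` repeats the last class, so that r + 1 classes yield d + 1 edges.
    (fun l A => A ∈ G ∧ A ∩ E = res f (C (min l r)) E)
    (fun B A => B ∈ G → ∀ v ∈ A, v ∉ E → v ∉ B) (d + 1) (by
      intro l hl Z hZ
      have hcard : ((Z ∩ G).biUnion id).card ≤ (d + 1) * k := by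
        refine (Finset.card_biUnion_le_card_mul _ _ k ?_).trans (Nat.mul_le_mul_right _ ?_)
        · intro A hA
          exact (hG A (Finset.mem_inter.1 hA).2).1.le
        · exact (Finset.card_le_card Finset.inter_subset_left).trans (by omega)
      obtain ⟨A, hA, h1, h2⟩ := (hC (min l r) (min_le_right _ _)).exists_inter_eq hG hE hcard
      refine ⟨A, ⟨hA, h1⟩, fun B hB hBG v hv hvE hvB => h2 v hv hvE ?_⟩
      exact Finset.mem_biUnion.2 ⟨B, Finset.mem_inter.2 ⟨hB, hBG⟩, hvB⟩)
  have hout : ∀ l < d + 1, ∃ v ∈ a l, v ∉ E := by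
    intro l hl
    by_contra! hsub
    have h1 := (ha1 l hl).2
    rw [Finset.inter_eq_left.2 hsub] at h1
    have h2 := (hG _ (ha1 l hl).1).1
    rw [h1, (hG E hE).card_res] at h2
    have h3 := Finset.card_pos.2 ⟨_, hq (min l r) (min_le_right _ _)⟩
    have := (q 0).2
    omega
  have hne' : ∀ j < d + 1, ∀ i < j, a i ≠ a j := by
    intro j hj i hij heq
    obtain ⟨v, hv, hvE⟩ := hout j hj
    exact ha2 j hj i hij (ha1 i (by omega)).1 v hv hvE (heq ▸ hv)
  have hinj : Set.InjOn a (Finset.range (d + 1)) := by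
    intro i hi j hj hij
    simp only [Finset.coe_range, Set.mem_Iio] at hi hj
    rcases lt_trichotomy i j with h1 | h1 | h1
    · exact absurd hij (hne' j hj i h1)
    · exact h1
    · exact absurd hij.symm (hne' i hi j h1)
  refine ⟨(Finset.range (d + 1)).image a, ?_, ?_, ?_, ?_⟩
  · intro A hA
    obtain ⟨l, hl, rfl⟩ := Finset.mem_image.1 hA
    exact (ha1 l (by simpa using hl)).1
  · rw [Finset.card_image_of_injOn hinj, Finset.card_range]
  · choose w hwE hw using fun l => (hG E hE).exists_mem (q l)
    have hwinj : Set.InjOn w (Finset.range (r + 1)) := by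
      intro i hi j hj hij
      simp only [Finset.coe_range, Set.mem_Iio] at hi hj
      have hqq : q i = q j := by rw [← hw i, ← hw j, hij]
      exact hqC i (by omega) j (by omega) (hqq ▸ hq j (by omega))
    refine isWiseIntersecting_of_points ((Finset.range (r + 1)).image w)
      (by rw [Finset.card_image_of_injOn hwinj, Finset.card_range]; omega) ?_
    intro A hA u hu v hv huA hvA
    obtain ⟨l, hl, rfl⟩ := Finset.mem_image.1 hA
    have key : ∀ x ∈ (Finset.range (r + 1)).image w, x ∉ a l → x = w (min l r) := by
      intro x hx hxA
      obtain ⟨i, hi, rfl⟩ := Finset.mem_image.1 hx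
      have hi' : i ≤ r := by simpa [Nat.lt_succ_iff] using hi
      have hmem : q i ∈ C (min l r) := by
        by_contra hn
        have : w i ∈ a l ∩ E := by
          rw [(ha1 l (by simpa using hl)).2]
          exact mem_res.2 ⟨hwE i, by rwa [hw i]⟩
        exact hxA (Finset.mem_inter.1 this).1
      rw [← hqC i hi' _ (min_le_right _ _) hmem]
    rw [key u hu huA, key v hv hvA]
  · rintro ⟨v, hv⟩
    have hv' : ∀ l < d + 1, v ∈ a l := fun l hl =>
      hv _ (Finset.mem_image_of_mem _ (by simpa using hl))
    by_cases hvE : v ∈ E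
    · obtain ⟨l, hl, hvl⟩ := hcov (f v)
      have : v ∈ a l ∩ E := Finset.mem_inter.2 ⟨hv' l (by omega), hvE⟩
      rw [(ha1 l (by omega)).2, min_eq_left hl] at this
      exact (mem_res.1 this).2 hvl
    · exact ha2 1 (by omega) 0 (by omega) (ha1 0 (by omega)).1 v (hv' 1 (by omega)) hvE
        (hv' 0 (by omega))

/-- Split the colours other than `b` into r + 1 classes, which `r + 2 ≤ k` allows. Colours outside
`B` are exchangeable alone, those in `B` together with `b`, so `b` joins every class meeting `B`. If
`B` has a second colour, `b` gets covered; if `B` is empty, `b` is itself exchangeable. -/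
lemma IsHomogeneous.hasNontrivial {f : V → Fin k} {r d s : ℕ} (hr : 1 ≤ r) (hrk : r + 2 ≤ k)
    (hrd : r ≤ d) (hs : (d + 1) * k + k < s) {B : Finset (Fin k)} (hB : B.card ≠ 1)
    {G : Finset (Finset V)} (hG : ∀ E ∈ G, IsRainbow f E) (hne : G.Nonempty)
    (h : IsHomogeneous f s B G) : HasNontrivial r d G := by
  have hb : ∃ b : Fin k, B.Nonempty → b ∈ B := by
    by_cases hBn : B.Nonempty
    · exact ⟨hBn.choose, fun _ => hBn.choose_spec⟩
    · exact ⟨⟨0, by omega⟩, fun h => absurd h hBn⟩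
  obtain ⟨b, hb⟩ := hb
  have hcard : r + 1 ≤ ((Finset.univ : Finset (Fin k)).erase b).card := by
    rw [Finset.card_erase_of_mem (Finset.mem_univ _), Finset.card_univ, Fintype.card_fin]
    omega
  obtain ⟨W, hW, hWcard⟩ := Finset.exists_subset_card_eq hcard
  have e : Fin (r + 1) ≃ W := (W.equivFinOfCardEq hWcard).symm
  -- `q` enumerates `r + 1` colours other than `b`, and `g` assigns all other colours to class `r`
  let q : ℕ → Fin k := fun l => e ⟨min l r, by omega⟩
  let g : Fin k → ℕ := fun c => if hc : c ∈ W then (e.symm ⟨c, hc⟩ : Fin (r + 1)) else r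
  have hqb : ∀ l, q l ≠ b := fun l => (Finset.mem_erase.1 (hW (e _).2)).1
  have hgr : ∀ c, g c ≤ r := by
    intro c
    simp only [g]
    split_ifs with hc
    · exact Nat.lt_succ_iff.1 (e.symm ⟨c, hc⟩).2
    · exact le_rfl
  have hgq : ∀ l ≤ r, g (q l) = l := by
    intro l hl
    simp only [g, q]
    rw [dif_pos (e _).2]
    simp [hl]
  let Q : ℕ → Finset (Fin k) := fun l => (Finset.univ.erase b).filter fun c => g c = l
  -- The classes may overlap, but only in `b`, which is no private colour.
  let C : ℕ → Finset (Fin k) := fun l =>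
    if B = ∅ ∨ (Q l ∩ B).Nonempty then insert b (Q l) else Q l
  have hQC : ∀ l, Q l ⊆ C l := by
    intro l
    simp only [C]
    split_ifs
    · exact Finset.subset_insert _ _
    · exact subset_rfl
  have hCQ : ∀ l c, c ∈ C l → c ≠ b → c ∈ Q l := by
    intro l c hc hcb
    simp only [C] at hc
    split_ifs at hc
    · exact (Finset.mem_insert.1 hc).resolve_left hcb
    · exact hc
  have hbC : ∀ l, b ∈ C l ↔ (B = ∅ ∨ (Q l ∩ B).Nonempty) := by
    intro l
    simp only [C]
    split_ifs with h'
    · simp [h']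
    · simp only [h', iff_false]
      simp [Q]
  have hqQ : ∀ l ≤ r, q l ∈ Q l := fun l hl =>
    Finset.mem_filter.2 ⟨Finset.mem_erase.2 ⟨hqb l, Finset.mem_univ _⟩, hgq l hl⟩
  have hQg : ∀ c, c ≠ b → c ∈ Q (g c) := fun c hc =>
    Finset.mem_filter.2 ⟨Finset.mem_erase.2 ⟨hc, Finset.mem_univ _⟩, rfl⟩
  refine hasNontrivial_of_cover hr hrd hG hne C q ?_ ?_ ?_ ?_
  · intro l hl
    refine IsExchangeable.of_cover fun c hc => ?_
    by_cases hcB : c ∈ B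
    · have hbB := hb ⟨c, hcB⟩
      by_cases hcb : c = b
      · subst hcb
        rcases (hbC l).1 hc with h1 | ⟨c', hc'⟩
        · rw [h1] at hbB
          simp at hbB
        · obtain ⟨hc1, hc2⟩ := Finset.mem_inter.1 hc'
          have hne' : c ≠ c' := by
            rintro rfl
            simp [Q] at hc1
          refine ⟨{c, c'}, ?_, by simp, h.isExchangeable_pair hs hG hcB hc2 hne'⟩
          intro x hx
          rcases Finset.mem_insert.1 hx with rfl | hx
          · exact hc
          · rw [Finset.mem_singleton.1 hx]
            exact hQC l hc1
      · have hb' : b ∈ C l :=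
          (hbC l).2 (Or.inr ⟨c, Finset.mem_inter.2 ⟨hCQ l c hc hcb, hcB⟩⟩)
        refine ⟨{c, b}, ?_, by simp, h.isExchangeable_pair hs hG hcB hbB hcb⟩
        intro x hx
        rcases Finset.mem_insert.1 hx with rfl | hx
        · exact hc
        · rw [Finset.mem_singleton.1 hx]
          exact hb'
    · exact ⟨{c}, by simpa using hc, by simp, h.isExchangeable_singleton hs hG hcB⟩
  · exact fun l hl => hQC l (hqQ l hl)
  · intro l hl l' hl' hmem
    have := (Finset.mem_filter.1 (hCQ l' _ hmem (hqb l))).2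
    rw [← this, hgq l hl]
  · intro c
    by_cases hcb : c = b
    · subst hcb
      by_cases hBe : B = ∅
      · exact ⟨0, by omega, (hbC 0).2 (Or.inl hBe)⟩
      · have hBn := Finset.nonempty_iff_ne_empty.2 hBe
        have h2 : 1 < B.card := by
          have := Finset.card_pos.2 hBn
          omega
        obtain ⟨c', hc', hne'⟩ := Finset.exists_mem_ne h2 c
        exact ⟨g c', hgr c', (hbC _).2 (Or.inr ⟨c', Finset.mem_inter.2 ⟨hQg c' hne', hc'⟩⟩)⟩
    · exact ⟨g c, hgr c, hQC _ (hQg c hcb)⟩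

end Exchange

/-! ### Consequences for arbitrary uniform families. -/

section Rainbow

variable {V : Type*} [DecidableEq V] [Fintype V]

/-- Overwriting a colouring on `E` by a fixed bijection makes `E` rainbow, and at most k^k
colourings have the same image. -/
lemma card_fun_le_mul_card_rainbow {k : ℕ} {E : Finset V} (hE : E.card = k) :
    Fintype.card (V → Fin k) ≤
      k ^ k * (Finset.univ.filter fun f : V → Fin k => Set.InjOn f E).card := by
  have e : E ≃ Fin k := E.equivFinOfCardEq hE
  let φ : (V → Fin k) → V → Fin k := fun f v => if hv : v ∈ E then e ⟨v, hv⟩ else f v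
  have h1 : (Finset.univ.image φ) ⊆ Finset.univ.filter fun f : V → Fin k => Set.InjOn f E := by
    intro f hf
    obtain ⟨g, -, rfl⟩ := Finset.mem_image.1 hf
    refine Finset.mem_filter.2 ⟨Finset.mem_univ _, ?_⟩
    intro u hu v hv huv
    simp only [Finset.mem_coe] at hu hv
    simp only [φ, hu, hv, dif_pos] at huv
    simpa using e.injective huv
  refine le_trans (Finset.card_le_mul_card_image (f := φ) Finset.univ (k ^ k) ?_)
    (Nat.mul_le_mul_left _ (Finset.card_le_card h1))
  intro g _
  have h2 := Finset.card_le_card_of_injOn (fun (f : V → Fin k) (v : E) => f v)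
    (s := Finset.univ.filter fun f => φ f = g) (t := Finset.univ)
    (fun _ _ => Finset.mem_univ _) (by
      intro f hf f' hf' hff
      have hf1 := (Finset.mem_filter.1 hf).2
      have hf2 := (Finset.mem_filter.1 hf').2
      funext v
      by_cases hv : v ∈ E
      · exact congrFun hff ⟨v, hv⟩
      · have := congrFun (hf1.trans hf2.symm) v
        simpa [φ, hv] using this)
  simpa [hE] using h2

lemma exists_rainbow {k : ℕ} (hk : 1 ≤ k) (G : Finset (Finset V)) (hG : ∀ E ∈ G, E.card = k) :
    ∃ f : V → Fin k, ∃ G' ⊆ G, (∀ E ∈ G', IsRainbow f E) ∧ G.card ≤ k ^ k * G'.card := by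
  have : Nonempty (Fin k) := ⟨⟨0, hk⟩⟩
  suffices h : ∃ f : V → Fin k,
      G.card ≤ k ^ k * (G.filter fun E : Finset V => Set.InjOn f (E : Set V)).card by
    obtain ⟨f, hf⟩ := h
    refine ⟨f, _, Finset.filter_subset _ _, fun E hE => ?_, hf⟩
    obtain ⟨h1, h2⟩ := Finset.mem_filter.1 hE
    exact ⟨hG E h1, h2⟩
  by_contra! hcon
  have h1 : ∑ f : V → Fin k, k ^ k * (G.filter fun E : Finset V => Set.InjOn f (E : Set V)).card <
      ∑ _f : V → Fin k, G.card :=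
    Finset.sum_lt_sum_of_nonempty Finset.univ_nonempty fun f _ => hcon f
  have h2 : ∑ f : V → Fin k, (G.filter fun E : Finset V => Set.InjOn f (E : Set V)).card =
      ∑ E ∈ G, (Finset.univ.filter fun f : V → Fin k => Set.InjOn f E).card := by
    simp only [Finset.card_filter]
    rw [Finset.sum_comm]
  rw [← Finset.mul_sum, h2, Finset.mul_sum] at h1
  have h3 : ∑ E ∈ G, Fintype.card (V → Fin k) ≤
      ∑ E ∈ G, k ^ k * (Finset.univ.filter fun f : V → Fin k => Set.InjOn f E).card :=
    Finset.sum_le_sum fun E hE => card_fun_le_mul_card_rainbow (hG E hE)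
  simp only [Finset.sum_const, smul_eq_mul, Finset.card_univ] at h1 h3
  rw [mul_comm] at h3
  omega

/-- The degree threshold in the cleaning procedures. -/
def degConst (k d : ℕ) : ℕ := (d + 2) * k + 1

/-- The constant of `exists_isCentered`. -/
def centerConst (k d : ℕ) : ℕ := k ^ k * homConst k (degConst k d) k

lemma exists_isCentered {k r d : ℕ} (hr : 1 ≤ r) (hrk : r + 2 ≤ k) (hrd : r ≤ d)
    (G : Finset (Finset V)) (hG : ∀ E ∈ G, E.card = k) (hfree : ¬ HasNontrivial r d G)
    (hcard : centerConst k d * (Fintype.card V).choose (k - 2) < G.card) :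
    ∃ E ∈ G, ∃ c, IsCentered ((d + 1) * k) G E c := by
  obtain ⟨f, G₁, hG₁, hrb, hle⟩ := exists_rainbow (by omega) G hG
  have hlt : homConst k (degConst k d) k * (Fintype.card V).choose (k - 2) < G₁.card := by
    have h := lt_of_lt_of_le hcard hle
    rw [centerConst, mul_assoc] at h
    exact lt_of_mul_lt_mul_left h (Nat.zero_le _)
  obtain ⟨B, G₂, hG₂, hne, hhom⟩ := exists_isHomogeneous f (degConst k d) k ∅ (by simp) G₁ hrb
    (by simp) hlt
  have hrb₂ : ∀ E ∈ G₂, IsRainbow f E := fun E hE => hrb E (hG₂ hE)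
  have hs : (d + 1) * k + k < degConst k d := by
    rw [degConst]
    ring_nf
    omega
  by_cases hB : B.card = 1
  · obtain ⟨b, rfl⟩ := Finset.card_eq_one.1 hB
    obtain ⟨E, hE⟩ := hne
    obtain ⟨c, hc⟩ := hhom.isCentered hs hrb₂ hE
    exact ⟨E, hG₁ (hG₂ hE), c, hc.mono (hG₂.trans hG₁)⟩
  · exact absurd ((hhom.hasNontrivial hr hrk hrd hs hB hrb₂ hne).mono (hG₂.trans hG₁)) hfree

/-- The constant of `card_le_mul_card_shadow`. -/
def shadowConst (k d : ℕ) : ℕ := k ^ k * (degConst k d * k)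

/-- Clean with one-colour types only. A nonempty remainder would be homogeneous with `B = ∅`, hence
not free of forbidden subfamilies. So every edge is deleted, under a label made of a colour and a
member of the shadow. -/
lemma card_le_mul_card_shadow {k r d : ℕ} (hr : 1 ≤ r) (hrk : r + 2 ≤ k) (hrd : r ≤ d)
    (G : Finset (Finset V)) (hG : ∀ E ∈ G, E.card = k) (hfree : ¬ HasNontrivial r d G) :
    G.card ≤ shadowConst k d * (∂ G).card := by
  obtain ⟨f, G₁, hG₁, hrb, hle⟩ := exists_rainbow (by omega) G hG
  have : Nonempty (Fin k) := ⟨⟨0, by omega⟩⟩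
  obtain ⟨G₂, hG₂, τ, h1, h2, h3⟩ := exists_clean
    (fun E : Finset V => (Finset.univ : Finset (Fin k)).image fun i => (i, res f {i} E))
    (degConst k d) G₁
  have hs : (d + 1) * k + k < degConst k d := by
    rw [degConst]
    ring_nf
    omega
  by_cases hne : G₂.Nonempty
  · refine absurd (IsHomogeneous.hasNontrivial (f := f) (B := ∅) hr hrk hrd hs (by simp)
      (fun E hE => hrb E (hG₂ hE)) hne ⟨by simp, ?_, by simp⟩)
      (fun h => hfree (h.mono (hG₂.trans hG₁)))
    intro i _ E hE
    refine (h1 E hE (i, res f {i} E) (Finset.mem_image_of_mem _ (Finset.mem_univ i))).trans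
      (Finset.card_le_card ?_)
    intro A hA
    simp only [Finset.mem_filter, Finset.mem_image, Prod.mk.injEq] at hA ⊢
    obtain ⟨hA, C', -, rfl, h⟩ := hA
    exact ⟨hA, h⟩
  · rw [Finset.not_nonempty_iff_eq_empty] at hne
    subst hne
    rw [Finset.sdiff_empty] at h2 h3
    have himg : G₁.image τ ⊆ (Finset.univ : Finset (Fin k)) ×ˢ ∂ G := by
      intro p hp
      obtain ⟨E, hE, rfl⟩ := Finset.mem_image.1 hp
      obtain ⟨i, -, hi⟩ := Finset.mem_image.1 (h2 E hE)
      rw [← hi, Finset.mem_product]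
      refine ⟨Finset.mem_univ _, ?_⟩
      obtain ⟨v, hv, hvi⟩ := (hrb E hE).exists_mem i
      refine Finset.mem_shadow_iff.2 ⟨E, hG₁ hE, v, hv, ?_⟩
      ext u
      simp only [Finset.mem_erase, mem_res, Finset.mem_singleton]
      constructor
      · rintro ⟨hne, hu⟩
        exact ⟨hu, fun h => hne ((hrb E hE).eq_of_mem hu hv (h.trans hvi.symm))⟩
      · rintro ⟨hu, hne⟩
        exact ⟨fun h => hne (h ▸ hvi), hu⟩
    have h4 := Finset.card_le_card himg
    rw [Finset.card_product, Finset.card_univ, Fintype.card_fin] at h4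
    calc G.card ≤ k ^ k * G₁.card := hle
      _ ≤ k ^ k * (degConst k d * (G₁.image τ).card) := Nat.mul_le_mul_left _
          (Finset.card_le_mul_card_image _ _ fun κ _ => h3 κ)
      _ ≤ k ^ k * (degConst k d * (k * (∂ G).card)) := by gcongr
      _ = _ := by rw [shadowConst]; ring

end Rainbow

/-! ### Centres and stability. -/

/-- If `c ∉ F`, take r points `S` of `E ∩ F`. Edges with trace `insert c (S.erase i)` on `E` that
otherwise avoid `F` feed `hasNontrivial_of_center` with `x = c`. -/
lemma IsCentered.mem_of_le_card_inter {V : Type*} [DecidableEq V] {k r d : ℕ} (hr : 1 ≤ r)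
    (hrk : r < k) (hrd : r ≤ d) {H : Finset (Finset V)} (hH : ∀ E ∈ H, E.card = k)
    (hfree : ¬ HasNontrivial r d H) {E F : Finset V} {c : V}
    (hc : IsCentered ((d + 1) * k) H E c) (hF : F ∈ H) (h : r ≤ (E ∩ F).card) : c ∈ F := by
  by_contra hcF
  obtain ⟨S, hS, hSr⟩ := Finset.exists_subset_card_eq h
  refine hfree (hasNontrivial_of_center hr hrd hF hcF (hS.trans Finset.inter_subset_right) hSr ?_)
  intro i hi Z hZ
  -- `k` vertices to avoid `F`, and `d * k` to differ from the edges in `Z`.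
  have hW : (F ∪ (Z ∩ H).biUnion id).card ≤ (d + 1) * k := by
    refine (Finset.card_union_le _ _).trans ?_
    have h1 : ((Z ∩ H).biUnion id).card ≤ d * k := by
      refine (Finset.card_biUnion_le_card_mul _ _ k ?_).trans (Nat.mul_le_mul_right _ ?_)
      · intro A hA
        exact (hH A (Finset.mem_inter.1 hA).2).le
      · exact (Finset.card_le_card Finset.inter_subset_left).trans hZ
    rw [hH F hF, add_mul]
    omega
  have hSE : ∀ v ∈ S, v ∈ E ∧ v ∈ F := fun v hv => Finset.mem_inter.1 (hS hv)
  have hT : insert c (S.erase i) ⊆ E := by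
    intro v hv
    rcases Finset.mem_insert.1 hv with rfl | hv
    · exact hc.1
    · exact (hSE v (Finset.mem_of_mem_erase hv)).1
  obtain ⟨A, hA, hAE, hAW⟩ := hc.2 _ hT (Finset.mem_insert_self _ _) _ hW
  have hTA : ∀ v ∈ insert c (S.erase i), v ∈ A := by
    intro v hv
    rw [← hAE] at hv
    exact (Finset.mem_inter.1 hv).1
  refine ⟨A, hA, ?_, hTA c (Finset.mem_insert_self _ _), ?_⟩
  · intro hAZ
    have hcard : (A ∩ E).card < A.card := by
      rw [hAE, hH A hA]
      refine (Finset.card_insert_le _ _).trans_lt ?_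
      rw [Finset.card_erase_of_mem hi]
      omega
    have hns : ¬ A ⊆ E := fun hsub => by
      rw [Finset.inter_eq_left.2 hsub] at hcard
      exact lt_irrefl _ hcard
    obtain ⟨v, hv, hvE⟩ := Finset.not_subset.1 hns
    exact hAW v hv hvE (Finset.mem_union_right _
      (Finset.mem_biUnion.2 ⟨A, Finset.mem_inter.2 ⟨hAZ, hA⟩, hv⟩))
  · ext v
    constructor
    · intro hv
      obtain ⟨hvA, hvF⟩ := Finset.mem_inter.1 hv
      by_cases hvE : v ∈ E
      · have : v ∈ A ∩ E := Finset.mem_inter.2 ⟨hvA, hvE⟩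
        rw [hAE] at this
        rcases Finset.mem_insert.1 this with rfl | h'
        · exact absurd hvF hcF
        · exact h'
      · exact absurd (Finset.mem_union_left _ hvF) (hAW v hvA hvE)
    · intro hv
      exact Finset.mem_inter.2 ⟨hTA v (Finset.mem_insert_of_mem hv),
        (hSE v (Finset.mem_of_mem_erase hv)).2⟩

/-- A consequence of the Lovász form of the Kruskal–Katona theorem. -/
lemma mul_card_le_mul_card_shadow {n q Y : ℕ} (hq : 1 ≤ q) (hY : Y ≤ n)
    (𝒜 : Finset (Finset (Fin n))) (h𝒜 : (𝒜 : Set (Finset (Fin n))).Sized q)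
    (hcard : 𝒜.card < Y.choose q) : q * 𝒜.card ≤ Y * (∂ 𝒜).card := by
  rcases Nat.eq_zero_or_pos 𝒜.card with h0 | hpos
  · simp [h0]
  have hqY : q ≤ Y := by
    by_contra! hlt
    rw [Nat.choose_eq_zero_of_lt hlt] at hcard
    omega
  have hP : q.choose q ≤ 𝒜.card := by simpa using hpos
  -- Now y.choose q ≤ |𝒜| < (y+1).choose q. Rounding to an integer is harmless, since q *
  -- (y+1).choose q = (y+1) * y.choose (q-1) and y + 1 ≤ Y.
  set y := Nat.findGreatest (fun y => y.choose q ≤ 𝒜.card) Y with hy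
  have hy1 : y.choose q ≤ 𝒜.card := Nat.findGreatest_spec (P := fun y => y.choose q ≤ 𝒜.card) hqY hP
  have hy2 : q ≤ y := Nat.le_findGreatest hqY hP
  have hy3 : y < Y := by
    refine lt_of_le_of_ne (Nat.findGreatest_le _) ?_
    intro h
    rw [h] at hy1
    omega
  have hy4 : 𝒜.card < (y + 1).choose q := by
    have := Nat.findGreatest_is_greatest (P := fun y => y.choose q ≤ 𝒜.card)
      (n := Y) (k := y + 1) (by omega) (by omega)
    omega
  have hkk := Finset.kruskal_katona_lovasz_form (i := 1) hq hy2 (by omega) h𝒜 hy1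
  rw [Function.iterate_one] at hkk
  obtain ⟨t, rfl⟩ : ∃ t, q = t + 1 := ⟨q - 1, by omega⟩
  rw [Nat.add_sub_cancel] at hkk
  calc (t + 1) * 𝒜.card ≤ (t + 1) * (y + 1).choose (t + 1) := Nat.mul_le_mul_left _ hy4.le
    _ = (y + 1) * y.choose t := by
        rw [mul_comm, ← Nat.add_one_mul_choose_eq]
    _ ≤ Y * (∂ 𝒜).card := Nat.mul_le_mul hy3 hkk

lemma choose_le_choose_sub_add (n t D : ℕ) :
    n.choose (t + 1) ≤ (n - D).choose (t + 1) + D * n.choose t := by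
  induction D with
  | zero => simp
  | succ D ih =>
    refine ih.trans ?_
    rcases Nat.eq_zero_or_pos (n - D) with h | h
    · rw [show n - (D + 1) = n - D by omega, add_mul]
      omega
    · obtain ⟨m, hm⟩ : ∃ m, n - D = m + 1 := ⟨n - D - 1, by omega⟩
      rw [show n - (D + 1) = m by omega, hm, Nat.choose_succ_succ, add_mul]
      have := Nat.choose_le_choose t (show m ≤ n by omega)
      simp only [Nat.succ_eq_add_one]
      omega

/-- The constant of `exists_star_large`. -/
def stabConst (k d : ℕ) : ℕ := (k - 1) + (k - 1) * (centerConst k d + 1)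

lemma exists_star_large {k r d n : ℕ} (hr : 1 ≤ r) (hrk : r + 2 ≤ k) (hrd : r ≤ d)
    (hn : stabConst k d ≤ n) (H : Finset (Finset (Fin n))) (hH : ∀ E ∈ H, E.card = k)
    (hfree : ¬ HasNontrivial r d H) (hcard : (n - 1).choose (k - 1) ≤ H.card) :
    ∃ x : Fin n, (n - 1).choose (k - 1) ≤
      (H.filter fun E => x ∈ E).card + stabConst k d * n.choose (k - 2) := by
  classical
  obtain ⟨t, rfl⟩ : ∃ t, k = t + 2 := ⟨k - 2, by omega⟩
  simp only [Nat.add_sub_cancel, show t + 2 - 1 = t + 1 by omega] at *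
  set m := (d + 1) * (t + 2) with hm
  set D := stabConst (t + 2) d with hD
  have hD' : D = (t + 1) + (t + 1) * (centerConst (t + 2) d + 1) := by
    rw [hD, stabConst]
    simp
  have hn1 : t + 1 ≤ n := by omega
  set Hc := H.filter fun E => ∃ c, IsCentered m H E c with hHc
  have hrest : (H \ Hc).card ≤ centerConst (t + 2) d * n.choose t := by
    by_contra! hlt
    have hsub : H \ Hc ⊆ H := Finset.sdiff_subset
    obtain ⟨E, hE, c, hc⟩ := exists_isCentered hr hrk hrd (H \ Hc)
      (fun E hE => hH E (hsub hE)) (fun h => hfree (h.mono hsub)) (by simpa using hlt)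
    rw [Finset.mem_sdiff] at hE
    exact hE.2 (Finset.mem_filter.2 ⟨hE.1, c, hc.mono hsub⟩)
  have hsplit : H.card = Hc.card + (H \ Hc).card := by
    have := Finset.card_sdiff_add_card_eq_card (show Hc ⊆ H from Finset.filter_subset _ _)
    omega
  have hex : ∀ E : Finset (Fin n), ∃ c : Fin n, E ∈ Hc → IsCentered m H E c := by
    intro E
    by_cases hE : E ∈ Hc
    · obtain ⟨c, hc⟩ := (Finset.mem_filter.1 hE).2
      exact ⟨c, fun _ => hc⟩
    · exact ⟨⟨0, by omega⟩, fun h => absurd h hE⟩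
  choose c hc using hex
  have hHcH : ∀ E ∈ Hc, E ∈ H := fun E hE => (Finset.mem_filter.1 hE).1
  have hcmem : ∀ E ∈ Hc, c E ∈ E := fun E hE => (hc E hE).1
  have hkey : ∀ E ∈ Hc, ∀ F ∈ H, r ≤ (E ∩ F).card → c E ∈ F := fun E hE F hF h =>
    (hc E hE).mem_of_le_card_inter hr (by omega) hrd hH hfree hF h
  have hinj : ∀ E ∈ Hc, ∀ F ∈ Hc, E.erase (c E) = F.erase (c F) → E = F := by
    intro E hE F hF h
    have hsub : E.erase (c E) ⊆ E ∩ F :=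
      Finset.subset_inter (Finset.erase_subset _ _) (h ▸ Finset.erase_subset _ _)
    have h1 := Finset.card_le_card hsub
    rw [Finset.card_erase_of_mem (hcmem E hE), hH E (hHcH E hE)] at h1
    have h2 : c E ∈ F := hkey E hE F (hHcH F hF) (by omega)
    have h3 : E ⊆ F := by
      intro v hv
      by_cases hvc : v = c E
      · exact hvc ▸ h2
      · exact (Finset.mem_inter.1 (hsub (Finset.mem_erase.2 ⟨hvc, hv⟩))).2
    exact Finset.eq_of_subset_of_card_le h3 (by rw [hH E (hHcH E hE), hH F (hHcH F hF)])
  let S : Fin n → Finset (Finset (Fin n)) := fun x =>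
    (Hc.filter fun E => c E = x).image fun E => E.erase (c E)
  have hScard : ∀ x, (S x).card = (Hc.filter fun E => c E = x).card := by
    intro x
    refine Finset.card_image_of_injOn ?_
    intro E hE F hF h
    exact hinj E (Finset.mem_filter.1 hE).1 F (Finset.mem_filter.1 hF).1 h
  have hsum : Hc.card = ∑ x, (S x).card := by
    rw [Finset.sum_congr rfl fun x _ => hScard x]
    exact Finset.card_eq_sum_card_fiberwise fun _ _ => Finset.mem_coe.2 (Finset.mem_univ _)
  have hSized : ∀ x, (S x : Set (Finset (Fin n))).Sized (t + 1) := by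
    intro x A hA
    obtain ⟨E, hE, rfl⟩ := Finset.mem_image.1 hA
    have hE := (Finset.mem_filter.1 hE).1
    rw [Finset.card_erase_of_mem (hcmem E hE), hH E (hHcH E hE)]
    omega
  -- A common member `R` has k - 2 ≥ r points, so each centre lies in both edges. Both edges then
  -- equal `R` plus the two centres, so they coincide and have the same centre.
  have hdisj : ∀ x ∈ (Finset.univ : Finset (Fin n)), ∀ y ∈ (Finset.univ : Finset (Fin n)),
      x ≠ y → Disjoint (∂ (S x)) (∂ (S y)) := by
    intro x _ y _ hxy
    rw [Finset.disjoint_left]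
    intro R hR hR'
    obtain ⟨A, hA, hRA, hRc⟩ := Finset.mem_shadow_iff_exists_mem_card_add_one.1 hR
    obtain ⟨A', hA', hRA', hRc'⟩ := Finset.mem_shadow_iff_exists_mem_card_add_one.1 hR'
    obtain ⟨E, hE, rfl⟩ := Finset.mem_image.1 hA
    obtain ⟨F, hF, rfl⟩ := Finset.mem_image.1 hA'
    obtain ⟨hE', rfl⟩ := Finset.mem_filter.1 hE
    obtain ⟨hF', rfl⟩ := Finset.mem_filter.1 hF
    clear hE hF
    rename' hE' => hE, hF' => hF
    rw [Finset.card_erase_of_mem (hcmem E hE), hH E (hHcH E hE)] at hRc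
    have hRE : R ⊆ E := hRA.trans (Finset.erase_subset _ _)
    have hRF : R ⊆ F := hRA'.trans (Finset.erase_subset _ _)
    have h1 := Finset.card_le_card (Finset.subset_inter hRE hRF)
    have h2 : c E ∈ F := hkey E hE F (hHcH F hF) (by omega)
    have h3 : c F ∈ E := hkey F hF E (hHcH E hE) (by rw [Finset.inter_comm]; omega)
    have h4 : ∀ G ∈ Hc, c E ∈ G → c F ∈ G → R ⊆ G → insert (c E) (insert (c F) R) = G := by
      intro G hG ha hb hRG
      refine Finset.eq_of_subset_of_card_le ?_ ?_
      · intro v hv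
        rcases Finset.mem_insert.1 hv with rfl | hv
        · exact ha
        · rcases Finset.mem_insert.1 hv with rfl | hv
          · exact hb
          · exact hRG hv
      · rw [Finset.card_insert_of_notMem, Finset.card_insert_of_notMem, hH G (hHcH G hG)]
        · omega
        · exact fun h => absurd (hRA' h) (by simp)
        · intro h
          rcases Finset.mem_insert.1 h with h | h
          · exact hxy h
          · exact absurd (hRA h) (by simp)
    have h5 := (h4 E hE (hcmem E hE) h3 hRE).symm.trans (h4 F hF h2 (hcmem F hF) hRF)
    exact hxy (by rw [h5])
  have hshadow : ∑ x, (∂ (S x)).card ≤ n.choose t := by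
    rw [← Finset.card_biUnion hdisj]
    have : Finset.univ.biUnion (fun x => ∂ (S x)) ⊆ Finset.powersetCard t Finset.univ := by
      intro R hR
      obtain ⟨x, -, hx⟩ := Finset.mem_biUnion.1 hR
      exact Finset.mem_powersetCard.2 ⟨Finset.subset_univ _, by simpa using (hSized x).shadow hx⟩
    simpa using Finset.card_le_card this
  -- If all links are small, adding up the shadow ratios over disjoint shadows bounds `Hc` too
  -- strongly. The spare summand k - 1 = t + 1 in `stabConst` turns the comparison into n - t ≤ n -
  -- (t + 1).
  by_cases hall : ∀ x, (S x).card < (n - D).choose (t + 1)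
  · exfalso
    have h1 : (t + 1) * Hc.card ≤ (n - D) * n.choose t := by
      rw [hsum, Finset.mul_sum]
      refine le_trans (Finset.sum_le_sum fun x _ =>
        mul_card_le_mul_card_shadow (by omega) (Nat.sub_le n D) (S x) (hSized x) (hall x)) ?_
      rw [← Finset.mul_sum]
      exact Nat.mul_le_mul_left _ hshadow
    have h2 := Nat.choose_succ_right_eq n t
    have h3 : n.choose (t + 1) ≤ (n - 1).choose (t + 1) + n.choose t := by
      simpa using choose_le_choose_sub_add n t 1
    have hX : 0 < n.choose t := Nat.choose_pos (by omega)
    have h4 : (n - t) * n.choose t ≤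
        (n - D + (t + 1) * (centerConst (t + 2) d + 1)) * n.choose t := by
      calc (n - t) * n.choose t = (t + 1) * n.choose (t + 1) := by rw [mul_comm, ← h2, mul_comm]
        _ ≤ (t + 1) * (Hc.card + centerConst (t + 2) d * n.choose t + n.choose t) :=
            Nat.mul_le_mul_left _ (by omega)
        _ = (t + 1) * Hc.card + (t + 1) * (centerConst (t + 2) d + 1) * n.choose t := by ring
        _ ≤ _ := by rw [add_mul (n - D)]; omega
    have h5 := Nat.le_of_mul_le_mul_right h4 hX
    omega
  · push Not at hall
    obtain ⟨x, hx⟩ := hall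
    refine ⟨x, ?_⟩
    have h1 := choose_le_choose_sub_add n t D
    have h2 := Nat.choose_le_choose (t + 1) (Nat.sub_le n 1)
    have h3 : (S x).card ≤ (H.filter fun E => x ∈ E).card := by
      rw [hScard]
      refine Finset.card_le_card fun E hE => ?_
      obtain ⟨hE', rfl⟩ := Finset.mem_filter.1 hE
      exact Finset.mem_filter.2 ⟨hHcH E hE', hcmem E hE'⟩
    omega

/-! ### Counting pairs of heavy sets. -/

section Counting

variable {V : Type*}

/-- Degree thresholds, decreasing fast as the size of the set decreases. -/
noncomputable def threshold (η : ℝ) (k n : ℕ) (T : Finset V) : ℝ :=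
  η ^ 3 ^ (k - T.card) * (n : ℝ) ^ (k - 1 - T.card)

lemma threshold_pos {η : ℝ} (hη : 0 < η) {k n : ℕ} (hn : 0 < n) (T : Finset V) :
    0 < threshold η k n T := by
  rw [threshold]
  positivity

variable [DecidableEq V]

/-- The number of edges of `M` containing `T`. -/
def setDegree (M : Finset (Finset V)) (T : Finset V) : ℕ :=
  (M.filter fun E => T ⊆ E).card

/-- The degree of `T` in `M` reaches the threshold. -/
def IsHeavy (η : ℝ) (k n : ℕ) (M : Finset (Finset V)) (T : Finset V) : Prop :=
  threshold η k n T ≤ setDegree M T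

lemma sum_setDegree_le {k : ℕ} (M : Finset (Finset V)) (hM : ∀ E ∈ M, E.card = k)
    (R : Finset V) (𝒯 : Finset (Finset V)) (h𝒯 : ∀ T ∈ 𝒯, R ⊆ T) :
    ∑ T ∈ 𝒯, setDegree M T ≤ 2 ^ k * setDegree M R := by
  have h1 : ∑ T ∈ 𝒯, setDegree M T =
      ∑ E ∈ M.filter (fun E => R ⊆ E), (𝒯.filter fun T => T ⊆ E).card := by
    have h2 : ∀ T ∈ 𝒯, setDegree M T =
        ((M.filter fun E => R ⊆ E).filter fun E => T ⊆ E).card := by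
      intro T hT
      rw [setDegree, Finset.filter_filter]
      congr 1
      ext E
      simp only [Finset.mem_filter]
      exact ⟨fun h => ⟨h.1, (h𝒯 T hT).trans h.2, h.2⟩, fun h => ⟨h.1, h.2.2⟩⟩
    rw [Finset.sum_congr rfl h2]
    simp only [Finset.card_filter]
    rw [Finset.sum_comm]
  rw [h1, setDegree, mul_comm, ← smul_eq_mul]
  refine Finset.sum_le_card_nsmul _ _ _ fun E hE => ?_
  have h3 : 𝒯.filter (fun T => T ⊆ E) ⊆ E.powerset := fun T hT =>
    Finset.mem_powerset.2 (Finset.mem_filter.1 hT).2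
  refine (Finset.card_le_card h3).trans ?_
  rw [Finset.card_powerset, hM E (Finset.mem_filter.1 hE).1]

variable [Fintype V]

lemma card_superset_le (a : ℕ) (U : Finset V) :
    ((Finset.powersetCard a (Finset.univ : Finset V)).filter fun D => U ⊆ D).card ≤
      Fintype.card V ^ (a - U.card) := by
  have h := Finset.card_le_card_of_injOn (fun D : Finset V => D \ U)
    (s := (Finset.powersetCard a (Finset.univ : Finset V)).filter fun D => U ⊆ D)
    (t := Finset.powersetCard (a - U.card) Finset.univ) (by
      intro D hD
      obtain ⟨h1, h2⟩ := Finset.mem_filter.1 hD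
      rw [Finset.mem_powersetCard] at h1
      refine Finset.mem_coe.2 (Finset.mem_powersetCard.2 ⟨Finset.subset_univ _, ?_⟩)
      rw [Finset.card_sdiff_of_subset h2, h1.2]) (by
      intro D hD D' hD' hDD
      have h1 := (Finset.mem_filter.1 hD).2
      have h2 := (Finset.mem_filter.1 hD').2
      rw [← Finset.sdiff_union_of_subset h1, ← Finset.sdiff_union_of_subset h2]
      simp only at hDD
      rw [hDD])
  rw [Finset.card_powersetCard, Finset.card_univ] at h
  exact h.trans (Nat.choose_le_pow _ _)

/-- The powers of n balance because |T ∪ T'| + |T ∩ T'| = |T| + |T'|. For η, the exponents of `T`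
and `T'` are each at most a third of that of `T ∩ T'`, which leaves the spare factor η. -/
lemma card_superset_union_le {η : ℝ} (hη : 0 < η) (hη1 : η ≤ 1) {k n : ℕ} (hn : 0 < n)
    (hV : Fintype.card V = n) (M : Finset (Finset V)) {T T' : Finset V}
    (hT : T.card < k) (hT' : T'.card < k) (h1 : (T ∩ T').card < T.card)
    (h2 : (T ∩ T').card < T'.card) (hheavy : IsHeavy η k n M T') :
    (((Finset.powersetCard (k - 1) (Finset.univ : Finset V)).filter
      fun D => T ∪ T' ⊆ D).card : ℝ) ≤
      η * threshold η k n T * setDegree M T' / threshold η k n (T ∩ T') := by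
  have hpos := threshold_pos hη hn (k := k) (T ∩ T')
  have hposT := threshold_pos hη hn (k := k) T
  rw [le_div_iff₀ hpos]
  refine le_trans ?_ (mul_le_mul_of_nonneg_left hheavy (by positivity))
  have hn' : (0 : ℝ) < n := by exact_mod_cast hn
  have hcu := Finset.card_union_add_card_inter T T'
  by_cases hU : (T ∪ T').card ≤ k - 1
  · have h3 : (((Finset.powersetCard (k - 1) (Finset.univ : Finset V)).filter
      fun D => T ∪ T' ⊆ D).card : ℝ) ≤ (n : ℝ) ^ (k - 1 - (T ∪ T').card) := by
      have := card_superset_le (k - 1) (T ∪ T')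
      rw [hV] at this
      exact_mod_cast this
    refine (mul_le_mul_of_nonneg_right h3 hpos.le).trans ?_
    simp only [threshold]
    have h4 : η ^ 3 ^ (k - (T ∩ T').card) ≤
        η * η ^ 3 ^ (k - T.card) * η ^ 3 ^ (k - T'.card) := by
      rw [← pow_succ', ← pow_add]
      refine pow_le_pow_of_le_one hη.le hη1 ?_
      have h5 : 3 ^ (k - T.card) ≤ 3 ^ (k - (T ∩ T').card - 1) :=
        Nat.pow_le_pow_right (by norm_num) (by omega)
      have h6 : 3 ^ (k - T'.card) ≤ 3 ^ (k - (T ∩ T').card - 1) :=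
        Nat.pow_le_pow_right (by norm_num) (by omega)
      have h7 : 3 ^ (k - (T ∩ T').card) = 3 ^ (k - (T ∩ T').card - 1) * 3 := by
        rw [← pow_succ]
        congr 1
        omega
      have h8 : 0 < 3 ^ (k - (T ∩ T').card - 1) := by positivity
      omega
    have h9 : (n : ℝ) ^ (k - 1 - (T ∪ T').card) * (n : ℝ) ^ (k - 1 - (T ∩ T').card) =
        (n : ℝ) ^ (k - 1 - T.card) * (n : ℝ) ^ (k - 1 - T'.card) := by
      rw [← pow_add, ← pow_add]
      congr 1
      omega
    calc (n : ℝ) ^ (k - 1 - (T ∪ T').card) *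
          (η ^ 3 ^ (k - (T ∩ T').card) * (n : ℝ) ^ (k - 1 - (T ∩ T').card))
        = η ^ 3 ^ (k - (T ∩ T').card) *
          ((n : ℝ) ^ (k - 1 - (T ∪ T').card) * (n : ℝ) ^ (k - 1 - (T ∩ T').card)) := by ring
      _ ≤ (η * η ^ 3 ^ (k - T.card) * η ^ 3 ^ (k - T'.card)) *
          ((n : ℝ) ^ (k - 1 - T.card) * (n : ℝ) ^ (k - 1 - T'.card)) := by
          rw [h9]
          gcongr
      _ = _ := by ring
  · have h3 : ((Finset.powersetCard (k - 1) (Finset.univ : Finset V)).filter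
      fun D => T ∪ T' ⊆ D) = ∅ := by
      refine Finset.filter_eq_empty_iff.2 fun D hD hUD => hU ?_
      rw [← (Finset.mem_powersetCard.1 hD).2]
      exact Finset.card_le_card hUD
    rw [h3, Finset.card_empty, Nat.cast_zero, zero_mul]
    have := threshold_pos hη hn (k := k) T'
    positivity

/-- A family of `(k - 1)`-sets each containing two heavy sets whose intersection is smaller than
both and not heavy has only a small fraction of the size of `M`. -/
lemma card_le_of_heavy_pairs {η : ℝ} (hη : 0 < η) (hη1 : η ≤ 1) {k n : ℕ} (hn : 0 < n)
    (hV : Fintype.card V = n) (M : Finset (Finset V)) (hM : ∀ E ∈ M, E.card = k)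
    (𝒟 : Finset (Finset V)) (h𝒟 : ∀ D ∈ 𝒟, D.card = k - 1 ∧ ∃ T ⊆ D, ∃ T' ⊆ D,
      T.card < k ∧ T'.card < k ∧ (T ∩ T').card < T.card ∧ (T ∩ T').card < T'.card ∧
      IsHeavy η k n M T ∧ IsHeavy η k n M T' ∧ ¬ IsHeavy η k n M (T ∩ T')) :
    (𝒟.card : ℝ) ≤ 8 ^ k * η * M.card := by
  classical
  let 𝒯 : Finset (Finset V) := Finset.univ.filter fun T => T.card < k ∧ IsHeavy η k n M T
  let ℛ : Finset V → Finset (Finset V) := fun T =>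
    T.powerset.filter fun R => R.card < T.card ∧ ¬ IsHeavy η k n M R
  let 𝒯' : Finset V → Finset V → Finset (Finset V) := fun T R =>
    𝒯.filter fun T' => T ∩ T' = R ∧ R.card < T'.card
  let 𝒰 : Finset V → Finset V → Finset (Finset V) := fun T T' =>
    (Finset.powersetCard (k - 1) (Finset.univ : Finset V)).filter fun D => T ∪ T' ⊆ D
  -- Summing over `T'` uses that `R = T ∩ T'` is light; then heaviness of `T` turns its threshold
  -- into a degree. The sums over `T'`, `R` and `T` each cost 2^k, whence 8^k.
  have hcov : 𝒟 ⊆ 𝒯.biUnion fun T => (ℛ T).biUnion fun R => (𝒯' T R).biUnion fun T' =>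
      𝒰 T T' := by
    intro D hD
    obtain ⟨hDc, T, hT, T', hT', h1, h2, h3, h4, h5, h6, h7⟩ := h𝒟 D hD
    refine Finset.mem_biUnion.2 ⟨T, Finset.mem_filter.2 ⟨Finset.mem_univ _, h1, h5⟩, ?_⟩
    refine Finset.mem_biUnion.2 ⟨T ∩ T', Finset.mem_filter.2
      ⟨Finset.mem_powerset.2 Finset.inter_subset_left, h3, h7⟩, ?_⟩
    refine Finset.mem_biUnion.2 ⟨T', Finset.mem_filter.2
      ⟨Finset.mem_filter.2 ⟨Finset.mem_univ _, h2, h6⟩, rfl, h4⟩, ?_⟩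
    exact Finset.mem_filter.2 ⟨Finset.mem_powersetCard.2 ⟨Finset.subset_univ _, hDc⟩,
      Finset.union_subset hT hT'⟩
  have hin : ∀ T ∈ 𝒯, ∀ R ∈ ℛ T,
      (((𝒯' T R).biUnion fun T' => 𝒰 T T').card : ℝ) ≤ 2 ^ k * (η * threshold η k n T) := by
    intro T hT R hR
    obtain ⟨-, hTk, -⟩ := Finset.mem_filter.1 hT
    obtain ⟨-, hRT, hRh⟩ := Finset.mem_filter.1 hR
    have hpos := threshold_pos hη hn (k := k) R
    have hposT := threshold_pos hη hn (k := k) T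
    have h1 : (((𝒯' T R).biUnion fun T' => 𝒰 T T').card : ℝ) ≤
        ∑ T' ∈ 𝒯' T R, ((𝒰 T T').card : ℝ) := by
      exact_mod_cast Finset.card_biUnion_le
    refine h1.trans ?_
    have h2 : ∑ T' ∈ 𝒯' T R, ((𝒰 T T').card : ℝ) ≤ ∑ T' ∈ 𝒯' T R,
        η * threshold η k n T / threshold η k n R * (setDegree M T' : ℝ) := by
      refine Finset.sum_le_sum fun T' hT' => ?_
      obtain ⟨h3, rfl, h5⟩ := Finset.mem_filter.1 hT'
      obtain ⟨-, h6, h7⟩ := Finset.mem_filter.1 h3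
      refine (card_superset_union_le hη hη1 hn hV M hTk h6 hRT h5 h7).trans (le_of_eq ?_)
      ring
    refine h2.trans ?_
    rw [← Finset.mul_sum]
    have h3 : (∑ T' ∈ 𝒯' T R, (setDegree M T' : ℝ)) ≤ 2 ^ k * setDegree M R := by
      exact_mod_cast sum_setDegree_le M hM R (𝒯' T R) (fun T' hT' => by
        rw [← (Finset.mem_filter.1 hT').2.1]
        exact Finset.inter_subset_right)
    rw [IsHeavy, not_le] at hRh
    calc η * threshold η k n T / threshold η k n R * ∑ T' ∈ 𝒯' T R, (setDegree M T' : ℝ)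
        ≤ η * threshold η k n T / threshold η k n R * (2 ^ k * threshold η k n R) := by
          gcongr
          exact h3.trans (by gcongr)
      _ = _ := by
          field_simp
  have hmid : ∀ T ∈ 𝒯, (((ℛ T).biUnion fun R => (𝒯' T R).biUnion fun T' => 𝒰 T T').card : ℝ) ≤
      2 ^ k * (2 ^ k * (η * setDegree M T)) := by
    intro T hT
    obtain ⟨-, hTk, hTh⟩ := Finset.mem_filter.1 hT
    have hposT := threshold_pos hη hn (k := k) T
    have h1 : (((ℛ T).biUnion fun R => (𝒯' T R).biUnion fun T' => 𝒰 T T').card : ℝ) ≤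
        ∑ R ∈ ℛ T, (((𝒯' T R).biUnion fun T' => 𝒰 T T').card : ℝ) := by
      exact_mod_cast Finset.card_biUnion_le
    refine h1.trans ((Finset.sum_le_card_nsmul _ _ _ (hin T hT)).trans ?_)
    rw [nsmul_eq_mul]
    have h2 : ((ℛ T).card : ℝ) ≤ 2 ^ k := by
      have h3 : (ℛ T).card ≤ 2 ^ T.card :=
        (Finset.card_filter_le _ _).trans (Finset.card_powerset T).le
      exact_mod_cast h3.trans (Nat.pow_le_pow_right (by norm_num) hTk.le)
    gcongr
    exact hTh
  have h1 : (𝒟.card : ℝ) ≤ ∑ T ∈ 𝒯,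
      (((ℛ T).biUnion fun R => (𝒯' T R).biUnion fun T' => 𝒰 T T').card : ℝ) := by
    exact_mod_cast (Finset.card_le_card hcov).trans Finset.card_biUnion_le
  refine h1.trans ((Finset.sum_le_sum hmid).trans ?_)
  rw [← Finset.mul_sum, ← Finset.mul_sum, ← Finset.mul_sum]
  have h2 : (∑ T ∈ 𝒯, (setDegree M T : ℝ)) ≤ 2 ^ k * M.card := by
    have h3 := sum_setDegree_le M hM ∅ 𝒯 (fun T _ => Finset.empty_subset T)
    have h4 : setDegree M ∅ = M.card := by simp [setDegree]
    rw [h4] at h3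
    exact_mod_cast h3
  calc (2 : ℝ) ^ k * (2 ^ k * (η * ∑ T ∈ 𝒯, (setDegree M T : ℝ)))
      ≤ 2 ^ k * (2 ^ k * (η * (2 ^ k * M.card))) := by gcongr
    _ = 8 ^ k * η * M.card := by
        rw [show (8 : ℝ) = 2 * 2 * 2 by norm_num, mul_pow, mul_pow]
        ring

end Counting

/-! ### Missing edges of a star, and the choice of the density. -/

section Main

variable {n : ℕ}

/-- The `k`-sets through `x` that are missing from `H`. -/
def missing (k : ℕ) (x : Fin n) (H : Finset (Finset (Fin n))) : Finset (Finset (Fin n)) :=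
  (Finset.powersetCard k Finset.univ).filter fun E => x ∈ E ∧ E ∉ H

lemma mem_missing {k : ℕ} {x : Fin n} {H : Finset (Finset (Fin n))} {E : Finset (Fin n)} :
    E ∈ missing k x H ↔ E.card = k ∧ x ∈ E ∧ E ∉ H := by
  simp [missing, Finset.mem_powersetCard]

lemma card_star_add_card_missing {k : ℕ} (hk : 1 ≤ k) (x : Fin n) (H : Finset (Finset (Fin n)))
    (hH : ∀ E ∈ H, E.card = k) :
    (H.filter fun E => x ∈ E).card + (missing k x H).card = (n - 1).choose (k - 1) := by
  have hdisj : Disjoint (H.filter fun E => x ∈ E) (missing k x H) := by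
    rw [Finset.disjoint_left]
    intro E hE hE'
    exact (mem_missing.1 hE').2.2 (Finset.mem_filter.1 hE).1
  rw [← Finset.card_union_of_disjoint hdisj]
  have h1 : (H.filter fun E => x ∈ E) ∪ missing k x H =
      (Finset.powersetCard (k - 1) (Finset.univ.erase x)).image (insert x) := by
    ext E
    simp only [Finset.mem_union, Finset.mem_filter, mem_missing, Finset.mem_image,
      Finset.mem_powersetCard]
    constructor
    · intro h
      have h2 : E.card = k ∧ x ∈ E := by
        rcases h with h | h
        · exact ⟨hH E h.1, h.2⟩
        · exact ⟨h.1, h.2.1⟩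
      refine ⟨E.erase x, ⟨Finset.erase_subset_erase x (Finset.subset_univ _), ?_⟩,
        Finset.insert_erase h2.2⟩
      rw [Finset.card_erase_of_mem h2.2, h2.1]
    · rintro ⟨U, ⟨hU, hUc⟩, rfl⟩
      have hx : x ∉ U := fun h => Finset.notMem_erase x _ (hU h)
      have hc : (insert x U).card = k := by
        rw [Finset.card_insert_of_notMem hx, hUc]
        omega
      by_cases hin : insert x U ∈ H
      · exact Or.inl ⟨hin, Finset.mem_insert_self _ _⟩
      · exact Or.inr ⟨hc, Finset.mem_insert_self _ _, hin⟩
  rw [h1, Finset.card_image_of_injOn, Finset.card_powersetCard,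
    Finset.card_erase_of_mem (Finset.mem_univ _), Finset.card_univ, Fintype.card_fin]
  intro U hU U' hU' h
  have hx : ∀ W ∈ Finset.powersetCard (k - 1) ((Finset.univ : Finset (Fin n)).erase x), x ∉ W :=
    fun W hW h => Finset.notMem_erase x _ ((Finset.mem_powersetCard.1 hW).1 h)
  rw [← Finset.erase_insert (hx U hU), ← Finset.erase_insert (hx U' hU')]
  exact congrArg (fun W => Finset.erase W x) h

/-- Few missing extensions of the sets `S.erase i` through `x` give a non-trivial subfamily. -/
lemma hasNontrivial_of_setDegree_lt {k r d : ℕ} (hr : 1 ≤ r) (hrk : r < k) (hrd : r ≤ d)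
    {H : Finset (Finset (Fin n))} {x : Fin n} {F S : Finset (Fin n)} (hF : F ∈ H)
    (hFk : F.card = k) (hx : x ∉ F) (hS : S ⊆ F) (hSr : S.card = r)
    (hdeg : ∀ i ∈ S, setDegree (missing k x H) (S.erase i) + d <
      (n - (k + 1)).choose (k - r)) : HasNontrivial r d H := by
  refine hasNontrivial_of_center hr hrd hF hx hS hSr fun i hi Z hZ => ?_
  by_contra! hcon
  have hTF : S.erase i ⊆ F := (Finset.erase_subset _ _).trans hS
  have hTc : (S.erase i).card = r - 1 := by rw [Finset.card_erase_of_mem hi, hSr]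
  -- Each `U ∈ P` gives a candidate `insert x (S.erase i ∪ U)` with the right trace on `F`; there
  -- are too many for all to be missing or in `Z`.
  let P := Finset.powersetCard (k - r) (insert x F)ᶜ
  have hP : ∀ U ∈ P, U.card = k - r ∧ ∀ v ∈ U, v ≠ x ∧ v ∉ F := by
    intro U hU
    obtain ⟨h1, h2⟩ := Finset.mem_powersetCard.1 hU
    refine ⟨h2, fun v hv => ?_⟩
    simpa using h1 hv
  have hsub : P.image (fun U => insert x (S.erase i ∪ U)) ⊆
      ((missing k x H).filter fun E => S.erase i ⊆ E) ∪ Z := by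
    intro A hA
    obtain ⟨U, hU, rfl⟩ := Finset.mem_image.1 hA
    obtain ⟨hUc, hUv⟩ := hP U hU
    by_cases hAZ : insert x (S.erase i ∪ U) ∈ Z
    · exact Finset.mem_union_right _ hAZ
    · refine Finset.mem_union_left _ (Finset.mem_filter.2 ⟨mem_missing.2
        ⟨?_, Finset.mem_insert_self _ _, fun hAH => ?_⟩, ?_⟩)
      · rw [Finset.card_insert_of_notMem, Finset.card_union_of_disjoint, hTc, hUc]
        · omega
        · rw [Finset.disjoint_left]
          exact fun v hv hvU => (hUv v hvU).2 (hTF hv)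
        · intro h
          rcases Finset.mem_union.1 h with h | h
          · exact hx (hTF h)
          · exact (hUv x h).1 rfl
      · refine hcon _ hAH hAZ (Finset.mem_insert_self _ _) ?_
        ext v
        simp only [Finset.mem_inter, Finset.mem_insert, Finset.mem_union]
        constructor
        · rintro ⟨rfl | h | h, hv⟩
          · exact absurd hv hx
          · exact h
          · exact absurd hv (hUv v h).2
        · exact fun h => ⟨Or.inr (Or.inl h), hTF h⟩
      · exact Finset.subset_union_left.trans (Finset.subset_insert _ _)
  have hinj : Set.InjOn (fun U => insert x (S.erase i ∪ U)) (P : Set (Finset (Fin n))) := by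
    have hrec : ∀ U ∈ P, insert x (S.erase i ∪ U) \ insert x F = U := by
      intro U hU
      ext v
      simp only [Finset.mem_sdiff, Finset.mem_insert, Finset.mem_union, not_or]
      constructor
      · rintro ⟨h1, h2, h3⟩
        rcases h1 with h1 | h1 | h1
        · exact absurd h1 h2
        · exact absurd (hTF h1) h3
        · exact h1
      · exact fun h => ⟨Or.inr (Or.inr h), (hP U hU).2 v h⟩
    intro U hU U' hU' h
    rw [← hrec U hU, ← hrec U' hU']
    exact congrArg (fun W => W \ insert x F) h
  have h1 := Finset.card_le_card hsub
  rw [Finset.card_image_of_injOn hinj, Finset.card_powersetCard, Finset.card_compl,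
    Fintype.card_fin, Finset.card_insert_of_notMem hx, hFk] at h1
  have h2 := h1.trans (Finset.card_union_le _ _)
  have h3 := hdeg i hi
  rw [setDegree] at h3
  omega

/-- Every r-subset of an edge avoiding `x` contains a heavy (r-1)-set. Given `D` in the shadow, take
a smallest heavy `T ⊆ D`, nonempty by `hempty`, and a heavy `T'` in `D` minus a point of `T`; there
is room since k - 2 ≥ r. By minimality `T ∩ T'` is light, so `card_le_of_heavy_pairs` applies. -/
lemma card_shadow_le {k r d : ℕ} {η : ℝ} (hη : 0 < η) (hη1 : η ≤ 1) (hr : 1 ≤ r)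
    (hrk : r + 2 ≤ k) (hrd : r ≤ d) (hn : 0 < n) {H : Finset (Finset (Fin n))}
    (hH : ∀ E ∈ H, E.card = k) (hfree : ¬ HasNontrivial r d H) (x : Fin n)
    (hempty : ¬ IsHeavy η k n (missing k x H) ∅)
    (hext : η * (n : ℝ) ^ (k - r) + d < (n - (k + 1)).choose (k - r)) :
    ((∂ (H.filter fun E => x ∉ E)).card : ℝ) ≤ 8 ^ k * η * (missing k x H).card := by
  classical
  set M := missing k x H with hM
  have hheavy : ∀ F ∈ H, x ∉ F → ∀ S ⊆ F, S.card = r → ∃ i ∈ S, IsHeavy η k n M (S.erase i) := by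
    intro F hF hx S hS hSr
    by_contra! hcon
    refine hfree (hasNontrivial_of_setDegree_lt hr (by omega) hrd hF (hH F hF) hx hS hSr
      fun i hi => ?_)
    have h1 := hcon i hi
    rw [IsHeavy, not_le, threshold, Finset.card_erase_of_mem hi, hSr,
      show k - 1 - (r - 1) = k - r by omega] at h1
    have h2 : η ^ 3 ^ (k - (r - 1)) ≤ η := by
      conv_rhs => rw [← pow_one η]
      exact pow_le_pow_of_le_one hη.le hη1 (Nat.one_le_pow _ _ (by norm_num))
    have h3 : (setDegree M (S.erase i) : ℝ) + d < (n - (k + 1)).choose (k - r) := by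
      have h4 : η ^ 3 ^ (k - (r - 1)) * (n : ℝ) ^ (k - r) ≤ η * (n : ℝ) ^ (k - r) := by gcongr
      linarith
    exact_mod_cast h3
  refine card_le_of_heavy_pairs hη hη1 hn (Fintype.card_fin n) M
    (fun E hE => (mem_missing.1 hE).1) _ fun D hD => ?_
  obtain ⟨F, hF, hDF, hDc⟩ := Finset.mem_shadow_iff_exists_mem_card_add_one.1 hD
  obtain ⟨hFH, hxF⟩ := Finset.mem_filter.1 hF
  rw [hH F hFH] at hDc
  have hget : ∀ D' ⊆ D, r ≤ D'.card → ∃ T ⊆ D', T.card < k ∧ IsHeavy η k n M T := by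
    intro D' hD' hc
    obtain ⟨S, hS, hSr⟩ := Finset.exists_subset_card_eq hc
    obtain ⟨i, hi, h⟩ := hheavy F hFH hxF S (hS.trans (hD'.trans hDF)) hSr
    refine ⟨S.erase i, (Finset.erase_subset _ _).trans hS, ?_, h⟩
    rw [Finset.card_erase_of_mem hi]
    omega
  obtain ⟨T₀, hT₀, hT₀k, hT₀h⟩ := hget D subset_rfl (by omega)
  obtain ⟨T, hT, hmin⟩ := Finset.exists_min_image
    (D.powerset.filter fun T => T.card < k ∧ IsHeavy η k n M T) Finset.card
    ⟨T₀, Finset.mem_filter.2 ⟨Finset.mem_powerset.2 hT₀, hT₀k, hT₀h⟩⟩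
  obtain ⟨hTD, hTk, hTh⟩ := Finset.mem_filter.1 hT
  rw [Finset.mem_powerset] at hTD
  have hTne : T.Nonempty := by
    rw [Finset.nonempty_iff_ne_empty]
    rintro rfl
    exact hempty hTh
  obtain ⟨t, ht⟩ := hTne
  obtain ⟨T', hT', hT'k, hT'h⟩ := hget (D.erase t) (Finset.erase_subset _ _) (by
    rw [Finset.card_erase_of_mem (hTD ht)]
    omega)
  have hT'D : T' ⊆ D := hT'.trans (Finset.erase_subset _ _)
  have hlt : (T ∩ T').card < T.card := by
    refine Finset.card_lt_card (Finset.ssubset_iff_of_subset Finset.inter_subset_left |>.2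
      ⟨t, ht, fun h => ?_⟩)
    exact Finset.notMem_erase t D (hT' (Finset.mem_inter.1 h).2)
  have hle : T.card ≤ T'.card :=
    hmin T' (Finset.mem_filter.2 ⟨Finset.mem_powerset.2 hT'D, hT'k, hT'h⟩)
  refine ⟨by omega, T, hTD, T', hT'D, hTk, hT'k, hlt, by omega, hTh, hT'h, fun hI => ?_⟩
  have := hmin (T ∩ T') (Finset.mem_filter.2 ⟨Finset.mem_powerset.2
    (Finset.inter_subset_left.trans hTD), by omega, hI⟩)
  omega

lemma pow_le_choose_sub {k a : ℕ} (ha : a ≤ k) (hn : 4 * k + 4 ≤ n) :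
    (n : ℝ) ^ a ≤ 2 ^ k * k.factorial * (n - (k + 1)).choose a := by
  have h1 : n ^ a ≤ 2 ^ a * (n - (k + 1) + 1 - a) ^ a := by
    rw [← mul_pow]
    exact Nat.pow_le_pow_left (by omega) a
  have h2 : (n - (k + 1) + 1 - a) ^ a ≤ a.factorial * (n - (k + 1)).choose a := by
    have := Nat.pow_le_choose (α := ℝ) a (n - (k + 1))
    rw [div_le_iff₀ (by positivity)] at this
    rw [mul_comm]
    exact_mod_cast this
  have h3 : n ^ a ≤ 2 ^ k * k.factorial * (n - (k + 1)).choose a := by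
    calc n ^ a ≤ 2 ^ a * (a.factorial * (n - (k + 1)).choose a) :=
          h1.trans (Nat.mul_le_mul_left _ h2)
      _ ≤ 2 ^ k * (k.factorial * (n - (k + 1)).choose a) := by
          have h4 := Nat.factorial_le ha
          have h5 := Nat.pow_le_pow_right (show 0 < 2 by norm_num) ha
          gcongr
      _ = _ := by ring
  exact_mod_cast h3

/-- The density parameter used for `threshold`. -/
noncomputable def density (k d : ℕ) : ℝ :=
  1 / (2 * ((shadowConst k d + 1) * 8 ^ k * k.factorial))

lemma density_pos (k d : ℕ) : 0 < density k d := by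
  rw [density]
  positivity

lemma density_le_one (k d : ℕ) : density k d ≤ 1 := by
  rw [density, div_le_one (by positivity)]
  have h1 : (1 : ℝ) ≤ 8 ^ k := one_le_pow₀ (by norm_num)
  have h2 : (1 : ℝ) ≤ k.factorial := by exact_mod_cast Nat.one_le_iff_ne_zero.2 k.factorial_ne_zero
  have h3 : (1 : ℝ) ≤ shadowConst k d + 1 := by
    have : (0 : ℝ) ≤ shadowConst k d := Nat.cast_nonneg _
    linarith
  have h4 : (1 : ℝ) ≤ (shadowConst k d + 1) * 8 ^ k * k.factorial :=
    one_le_mul_of_one_le_of_one_le (one_le_mul_of_one_le_of_one_le h3 h1) h2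
  linarith

lemma density_mul_shadowConst (k d : ℕ) : 2 * (shadowConst k d * (8 ^ k * density k d)) ≤ 1 := by
  have h2 : (1 : ℝ) ≤ k.factorial := by exact_mod_cast Nat.one_le_iff_ne_zero.2 k.factorial_ne_zero
  have h3 : (0 : ℝ) ≤ shadowConst k d := Nat.cast_nonneg _
  have h4 : (0 : ℝ) < 8 ^ k := by positivity
  rw [density, show 2 * ((shadowConst k d : ℝ) * (8 ^ k *
    (1 / (2 * ((shadowConst k d + 1) * 8 ^ k * k.factorial))))) =
    shadowConst k d / ((shadowConst k d + 1) * k.factorial) by field_simp]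
  rw [div_le_one (by positivity)]
  nlinarith

/-- The factor 2 leaves room for the extra `d` in the hypothesis `hext` of `card_shadow_le`. -/
lemma density_mul_pow_le {k a d : ℕ} (ha : a ≤ k) (hn : 4 * k + 4 ≤ n) :
    2 * (density k d * (n : ℝ) ^ a) ≤ (n - (k + 1)).choose a := by
  have h1 := pow_le_choose_sub ha hn
  have h2 : (2 : ℝ) ^ k * k.factorial ≤ (shadowConst k d + 1) * 8 ^ k * k.factorial := by
    have h3 : (2 : ℝ) ^ k ≤ 8 ^ k := pow_le_pow_left₀ (by norm_num) (by norm_num) k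
    have h4 : (0 : ℝ) ≤ shadowConst k d * 8 ^ k := by positivity
    gcongr
    linarith
  have h5 : (n : ℝ) ^ a ≤
      (shadowConst k d + 1) * 8 ^ k * k.factorial * (n - (k + 1)).choose a :=
    h1.trans (by gcongr)
  rw [density]
  calc 2 * (1 / (2 * (((shadowConst k d : ℝ) + 1) * 8 ^ k * k.factorial)) * (n : ℝ) ^ a)
      = (n : ℝ) ^ a / ((shadowConst k d + 1) * 8 ^ k * k.factorial) := by field_simp
    _ ≤ _ := by
      rw [div_le_iff₀ (by positivity)]
      linarith

end Main

end WiseIntersecting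

/-! ### Assembly. -/

open WiseIntersecting in
theorem theorem1p5 (k d : ℕ) :
    ∃ n₀ : ℕ, ∀ p : ℕ, 3 ≤ p → p < k → p ≤ d →
      ∀ n : ℕ, n₀ ≤ n →
        ∀ H : Finset (Finset (Fin n)), H ⊆ Finset.powersetCard k Finset.univ →
          (¬ ∃ F : Finset (Finset (Fin n)), F ⊆ H ∧ F.card = d + 1 ∧
            WiseIntersecting.IsNontrivialWiseIntersecting (p - 1) F) →
          H.card ≤ (n - 1).choose (k - 1) ∧
            (H.card = (n - 1).choose (k - 1) → WiseIntersecting.IsStar H) := by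
  have hη := density_pos k d
  set η := density k d with hηdef
  have hη1 : η ≤ 1 := density_le_one k d
  -- `n₁` makes the empty set light for the missing edges; `n₂` gives d < η n.
  obtain ⟨n₁, hn₁⟩ := exists_nat_gt ((stabConst k d : ℝ) / η ^ 3 ^ k)
  obtain ⟨n₂, hn₂⟩ := exists_nat_gt ((d : ℝ) / η)
  refine ⟨n₁ + n₂ + stabConst k d + 4 * k + 4, ?_⟩
  intro p hp3 hpk hpd n hn H hHsub hfree
  have hH : ∀ E ∈ H, E.card = k := fun E hE => (Finset.mem_powersetCard.1 (hHsub hE)).2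
  by_cases hcard : (n - 1).choose (k - 1) ≤ H.card
  swap
  · exact ⟨by omega, fun h => absurd h.ge hcard⟩
  have hfree : ¬ HasNontrivial (p - 1) d H := hfree
  have hnpos : (0 : ℝ) < n := by
    have : 0 < n := by omega
    exact_mod_cast this
  obtain ⟨x, hx⟩ := exists_star_large (by omega) (by omega) (by omega) (by omega) H hH hfree hcard
  have hsm := card_star_add_card_missing (by omega) x H hH
  have hM : (missing k x H).card ≤ stabConst k d * n.choose (k - 2) := by omega
  have hempty : ¬ IsHeavy η k n (missing k x H) ∅ := by
    rw [IsHeavy, not_le, threshold, Finset.card_empty, Nat.sub_zero, Nat.sub_zero]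
    have h1 : (setDegree (missing k x H) ∅ : ℝ) ≤ stabConst k d * (n : ℝ) ^ (k - 2) := by
      have h2 : setDegree (missing k x H) ∅ = (missing k x H).card := by simp [setDegree]
      rw [h2]
      exact_mod_cast hM.trans (Nat.mul_le_mul_left _ (Nat.choose_le_pow _ _))
    have h3 : (stabConst k d : ℝ) < η ^ 3 ^ k * n := by
      rw [div_lt_iff₀ (by positivity)] at hn₁
      have h4 : (n₁ : ℝ) ≤ n := by exact_mod_cast (by omega : n₁ ≤ n)
      calc (stabConst k d : ℝ) < n₁ * η ^ 3 ^ k := hn₁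
        _ ≤ n * η ^ 3 ^ k := by gcongr
        _ = _ := mul_comm _ _
    calc (setDegree (missing k x H) ∅ : ℝ) ≤ stabConst k d * (n : ℝ) ^ (k - 2) := h1
      _ < η ^ 3 ^ k * n * (n : ℝ) ^ (k - 2) := by gcongr
      _ = η ^ 3 ^ k * (n : ℝ) ^ (k - 1) := by
          rw [mul_assoc, ← pow_succ']
          congr 2
          omega
  have hext : η * (n : ℝ) ^ (k - (p - 1)) + d < (n - (k + 1)).choose (k - (p - 1)) := by
    have h1 := density_mul_pow_le (n := n) (k := k) (d := d) (a := k - (p - 1)) (by omega) (by omega)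
    have h2 : (d : ℝ) < η * (n : ℝ) ^ (k - (p - 1)) := by
      rw [div_lt_iff₀ hη] at hn₂
      have h4 : (n₂ : ℝ) ≤ n := by exact_mod_cast (by omega : n₂ ≤ n)
      have h5 : (n : ℝ) ≤ (n : ℝ) ^ (k - (p - 1)) := by
        refine le_self_pow₀ ?_ (by omega)
        exact_mod_cast (by omega : 1 ≤ n)
      calc (d : ℝ) < n₂ * η := hn₂
        _ ≤ (n : ℝ) ^ (k - (p - 1)) * η := by
            gcongr
            exact h4.trans h5
        _ = _ := mul_comm _ _
    rw [← hηdef] at h1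
    linarith
  have hshadow := card_shadow_le hη hη1 (by omega) (by omega) (by omega) (by omega) hH hfree x
    hempty hext
  have hN := card_le_mul_card_shadow (r := p - 1) (by omega) (by omega) (by omega)
    (H.filter fun E => x ∉ E) (fun E hE => hH E (Finset.mem_filter.1 hE).1)
    (fun h => hfree (h.mono (Finset.filter_subset _ _)))
  have hNM : 2 * (H.filter fun E => x ∉ E).card ≤ (missing k x H).card := by
    have h1 : ((H.filter fun E => x ∉ E).card : ℝ) ≤
        shadowConst k d * (8 ^ k * η * (missing k x H).card) := by
      refine le_trans (by exact_mod_cast hN) (mul_le_mul_of_nonneg_left hshadow (by positivity))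
    have h2 := density_mul_shadowConst k d
    rw [← hηdef] at h2
    have h3 : (2 : ℝ) * (H.filter fun E => x ∉ E).card ≤ (missing k x H).card := by
      calc (2 : ℝ) * (H.filter fun E => x ∉ E).card
          ≤ 2 * (shadowConst k d * (8 ^ k * η * (missing k x H).card)) := by gcongr
        _ = 2 * (shadowConst k d * (8 ^ k * η)) * (missing k x H).card := by ring
        _ ≤ 1 * (missing k x H).card := by gcongr
        _ = _ := one_mul _
    exact_mod_cast h3
  have hsplit := Finset.card_filter_add_card_filter_not (s := H) (fun E => x ∈ E)
  -- Equality would give |M| = |N|, which together with 2|N| ≤ |M| leaves no edge avoiding `x`.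
  refine ⟨by omega, fun heq => ⟨x, fun E hE => ?_⟩⟩
  by_contra hxE
  have h1 : 0 < (H.filter fun E => x ∉ E).card :=
    Finset.card_pos.2 ⟨E, Finset.mem_filter.2 ⟨hE, hxE⟩⟩
  omega
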